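/- Let $\mathbb{G}=(A,\Delta)$ be a compact quantum group whose (nonzero, unital) $C^*$-algebra $A$ has finite linear dimension $N$; that is, $\Delta\colon A\to A\otimes A$ is a coassociative unital $*$-homomorphism such that $\Delta(A)(A\otimes 1)$ and $\Delta(A)(1\otimes A)$ each span $A\otimes A$. Let $A_0$ be the Hopf algebra spanned by the matrix coefficients of the finite dimensional unitary corepresentations of $\mathbb{G}$. Then $\mathbb{G}$ has a unique Haar state $h$ (a state with $(\mathrm{id}\otimes h)\Delta(a)=h(a)1=(h\otimes\mathrm{id})\Delta(a)$ for all $a\in A$), $h$ is a trace, and $A_0$ has a unique counit $\varepsilon\colon A_0\to\mathbb{C}$. Let $\pi_h$ be the GNS representation of $A$ with respect to $h$, let $\mathscr{M}=\pi_h(A)''$ with the tracial state extending $h$ (the vector state of the class of $1$ in $L^2(A,h)$), and let $$H_n^{(2)}(\mathbb{G})=\operatorname{Tor}_n^{A_0}(\mathscr{M},\mathbb{C})\qquad(n\ge 0),$$ a left $\mathscr{M}$-module, where $\mathscr{M}$ is a right $A_0$-module via $\pi_h$ and $\mathbb{C}$ is a left $A_0$-module via $\varepsilon$. Let $\beta_n^{(2)}(\mathbb{G})=\dim_{\mathscr{M}}H_n^{(2)}(\mathbb{G})$,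 where $\dim_{\mathscr M}$ is Lück's extended dimension function: the dimension of a finitely generated projective module $\mathscr{M}^k e$ ($e$ an idempotent $k\times k$ matrix) is the trace of $e$, and the dimension of an arbitrary module is the supremum of the dimensions of its finitely generated projective submodules. Let $c_n(\mathbb{G})=c(H_n^{(2)}(\mathbb{G}))\in\{0^-\}\cup[0,\infty]$, where $0^-<0$ and $c$ is the capacity of Lück, Reich and Schick, defined as follows. For a finitely presented module $L=\operatorname{coker}(f\colon\mathscr{M}^k\to\mathscr{M}^l)$ with $\dim_{\mathscr M}L=0$, let $F$ be the spectral density function of $f$; put $c(L)=1/\alpha$ with $\alpha=\liminf_{\lambda\searrow0}\frac{\ln(F(\lambda)-F(0))}{\ln\lambda}\in[0,\infty]$ if $F(\lambda)>F(0)$ for all $\lambda>0$, and $c(L)=0^-$ otherwise. A quotient of such an $L$ is called measurable, and its capacity is the infimum of $c(L)$ over all such $L$ mapping onto it. A module all of whose finitely generated submodules are measurable is called cofinal-measurable, and its capacity is the supremum of the capacities of its finitely generated submodules. The capacity of an arbitrary module is the supremum of the capacities of its cofinal-measurable submodules. Then $$\beta_0^{(2)}(\mathbb{G})=\frac1N,\qquad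 \beta_n^{(2)}(\mathbb{G})=0\ \text{ for all } n\ge1,\qquad c_n(\mathbb{G})=0^-\ \text{ for all } n\ge0 .$$ -/

import Mathlib

universe u

open scoped TensorProduct ComplexOrder ENNReal Topology InnerProductSpace
open CategoryTheory

/-! ## Compact quantum groups with finite dimensional algebra -/

/-- A compact quantum group `(A, Δ)` in the sense of Woronowicz whose unital C⋆-algebra `A` is
finite dimensional.  For finite dimensional `A` the algebraic tensor product `A ⊗ A` is already
the C⋆-algebraic tensor product, and a dense subspace of it is the whole space; hence the
density (cancellation) conditions take the form below. -/
structure CompactQuantumGroup (A : Type u) [CStarAlgebra A] [FiniteDimensional ℂ A] where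
  /-- the comultiplication, a unital `*`-homomorphism -/
  comul : A →⋆ₐ[ℂ] A ⊗[ℂ] A
  coassoc :
    TensorProduct.assoc ℂ A A A ∘ₗ comul.toAlgHom.toLinearMap.rTensor A ∘ₗ
        comul.toAlgHom.toLinearMap =
      comul.toAlgHom.toLinearMap.lTensor A ∘ₗ comul.toAlgHom.toLinearMap
  span_comul_mul_left :
    Submodule.span ℂ {x | ∃ a b : A, x = comul b * (a ⊗ₜ[ℂ] (1 : A))} = ⊤
  span_comul_mul_right :
    Submodule.span ℂ {x | ∃ a b : A, x = comul b * ((1 : A) ⊗ₜ[ℂ] a)} = ⊤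

namespace CompactQuantumGroup

variable {A : Type u} [CStarAlgebra A] [FiniteDimensional ℂ A] (G : CompactQuantumGroup A)

/-- `h` is the Haar state: an invariant state. -/
structure IsHaarState [PartialOrder A] (h : A →ₚ[ℂ] ℂ) : Prop where
  map_one : h 1 = 1
  left_invariant : ∀ a : A,
    TensorProduct.rid ℂ A (h.toLinearMap.lTensor A (G.comul a)) = algebraMap ℂ A (h a)
  right_invariant : ∀ a : A,
    TensorProduct.lid ℂ A (h.toLinearMap.rTensor A (G.comul a)) = algebraMap ℂ A (h a)

/-- A finite dimensional unitary corepresentation, as a unitary matrix over `A`. -/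
structure IsUnitaryCorep {ι : Type} [Fintype ι] [DecidableEq ι] (v : Matrix ι ι A) : Prop where
  unitary : v ∈ unitary (Matrix ι ι A)
  comul_apply : ∀ i j, G.comul (v i j) = ∑ k, v i k ⊗ₜ[ℂ] v k j

/-- The matrix coefficients of the finite dimensional unitary corepresentations. -/
def matrixCoefficients : Set A :=
  {a | ∃ (ι : Type) (_ : Fintype ι) (_ : DecidableEq ι) (v : Matrix ι ι A),
    G.IsUnitaryCorep v ∧ ∃ i j, v i j = a}

theorem one_mem_matrixCoefficients : (1 : A) ∈ G.matrixCoefficients :=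
  ⟨Unit, inferInstance, inferInstance, 1,
    ⟨one_mem _, fun _ _ => by simp [Algebra.TensorProduct.one_def]⟩, (), (), by simp⟩

theorem mul_mem_matrixCoefficients {a b : A} (ha : a ∈ G.matrixCoefficients)
    (hb : b ∈ G.matrixCoefficients) : a * b ∈ G.matrixCoefficients := by
  obtain ⟨ι, _, _, v, ⟨hv, hv'⟩, i, j, rfl⟩ := ha
  obtain ⟨κ, _, _, w, ⟨hw, hw'⟩, k, l, rfl⟩ := hb
  rw [Unitary.mem_iff] at hv hw
  obtain ⟨hv1, hv2⟩ := hv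
  obtain ⟨hw1, hw2⟩ := hw
  have ev1 : ∀ p q, ∑ r, star (v r p) * v r q = if p = q then 1 else 0 := fun p q => by
    simpa [Matrix.mul_apply, Matrix.one_apply] using congrFun (congrFun hv1 p) q
  have ev2 : ∀ p q, ∑ r, v p r * star (v q r) = if p = q then 1 else 0 := fun p q => by
    simpa [Matrix.mul_apply, Matrix.one_apply] using congrFun (congrFun hv2 p) q
  have ew1 : ∀ p q, ∑ r, star (w r p) * w r q = if p = q then 1 else 0 := fun p q => by
    simpa [Matrix.mul_apply, Matrix.one_apply] using congrFun (congrFun hw1 p) q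
  have ew2 : ∀ p q, ∑ r, w p r * star (w q r) = if p = q then 1 else 0 := fun p q => by
    simpa [Matrix.mul_apply, Matrix.one_apply] using congrFun (congrFun hw2 p) q
  refine ⟨ι × κ, inferInstance, inferInstance,
    Matrix.of fun x y => v x.1 y.1 * w x.2 y.2, ⟨?_, ?_⟩, (i, k), (j, l), rfl⟩
  · rw [Unitary.mem_iff]
    constructor
    · ext ⟨p, q⟩ ⟨p', q'⟩
      simp only [Matrix.mul_apply, Matrix.star_apply, Matrix.of_apply, star_mul,
        Matrix.one_apply, Prod.mk.injEq, Fintype.sum_prod_type_right]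
      have : ∀ y, ∑ x, star (w y q) * star (v x p) * (v x p' * w y q') =
          star (w y q) * (if p = p' then 1 else 0) * w y q' := fun y => by
        rw [← ev1, Finset.mul_sum, Finset.sum_mul]
        simp only [mul_assoc]
      simp only [this]
      by_cases hp : p = p' <;> simp [hp, ew1]
    · ext ⟨p, q⟩ ⟨p', q'⟩
      simp only [Matrix.mul_apply, Matrix.star_apply, Matrix.of_apply, star_mul,
        Matrix.one_apply, Prod.mk.injEq, Fintype.sum_prod_type]
      have : ∀ x, ∑ y, v p x * w q y * (star (w q' y) * star (v p' x)) =
          v p x * (if q = q' then 1 else 0) * star (v p' x) := fun x => by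
        rw [← ew2, Finset.mul_sum, Finset.sum_mul]
        simp only [mul_assoc]
      simp only [this]
      by_cases hq : q = q' <;> simp [hq, ev2]
  · rintro ⟨p, q⟩ ⟨p', q'⟩
    simp only [Matrix.of_apply, map_mul, hv', hw', Finset.sum_mul, Finset.mul_sum,
      Fintype.sum_prod_type, Algebra.TensorProduct.tmul_mul_tmul]
    exact Finset.sum_comm

/-- The algebra `A₀` of matrix coefficients: the linear span of the matrix coefficients of
the finite dimensional unitary corepresentations. -/
noncomputable def coeffAlgebra : Subalgebra ℂ A where
  __ := (Submodule.span ℂ G.matrixCoefficients)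
  one_mem' := Submodule.subset_span G.one_mem_matrixCoefficients
  mul_mem' {a b} ha hb := by
    have := Submodule.mul_mem_mul (M := Submodule.span ℂ G.matrixCoefficients)
      (N := Submodule.span ℂ G.matrixCoefficients) ha hb
    rw [Submodule.span_mul_span] at this
    refine Submodule.span_mono ?_ this
    rintro _ ⟨x, hx, y, hy, rfl⟩
    exact G.mul_mem_matrixCoefficients hx hy
  algebraMap_mem' r := by
    rw [Algebra.algebraMap_eq_smul_one]
    exact Submodule.smul_mem _ _ (Submodule.subset_span G.one_mem_matrixCoefficients)

/-- `ε` is the counit of the Hopf algebra `A₀`: the comultiplication of `A` maps `a ∈ A₀` to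
an element `x` of `A₀ ⊗ A₀` with `(ε ⊗ id) x = a = (id ⊗ ε) x`. -/
def IsCounit (ε : G.coeffAlgebra →ₐ[ℂ] ℂ) : Prop :=
  ∀ a : G.coeffAlgebra, ∃ x : G.coeffAlgebra ⊗[ℂ] G.coeffAlgebra,
    TensorProduct.map G.coeffAlgebra.val.toLinearMap G.coeffAlgebra.val.toLinearMap x =
        G.comul (a : A) ∧
      TensorProduct.lid ℂ G.coeffAlgebra (ε.toLinearMap.rTensor G.coeffAlgebra x) = a ∧
      TensorProduct.rid ℂ G.coeffAlgebra (ε.toLinearMap.lTensor G.coeffAlgebra x) = a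

end CompactQuantumGroup

/-! ## The enveloping von Neumann algebra and its vector state -/

section Enveloping

variable {A : Type u} [CStarAlgebra A] [PartialOrder A] [StarOrderedRing A] (h : A →ₚ[ℂ] ℂ)

/-- The enveloping von Neumann algebra `π_h(A)''` in the GNS representation of `h`. -/
noncomputable def envelopingVN : VonNeumannAlgebra h.GNS where
  __ := StarSubalgebra.centralizer ℂ
    (StarSubalgebra.centralizer ℂ (h.gnsStarAlgHom.range : Set (h.GNS →L[ℂ] h.GNS)) :
      Set (h.GNS →L[ℂ] h.GNS))
  centralizer_centralizer' := by simp

theorem gns_mem_envelopingVN (a : A) : h.gnsStarAlgHom a ∈ envelopingVN h := by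
  have H : h.gnsStarAlgHom a ∈ StarSubalgebra.centralizer ℂ
      (StarSubalgebra.centralizer ℂ (h.gnsStarAlgHom.range : Set (h.GNS →L[ℂ] h.GNS)) :
        Set (h.GNS →L[ℂ] h.GNS)) := by
    rw [StarSubalgebra.mem_centralizer_iff]
    intro g hg
    have hg' : g ∈ StarSubalgebra.centralizer ℂ
        (h.gnsStarAlgHom.range : Set (h.GNS →L[ℂ] h.GNS)) := hg
    have hs : star g ∈ StarSubalgebra.centralizer ℂ
        (h.gnsStarAlgHom.range : Set (h.GNS →L[ℂ] h.GNS)) := star_mem hg'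
    rw [StarSubalgebra.mem_centralizer_iff] at hg' hs
    exact ⟨((hg' _ ⟨a, rfl⟩).1).symm, ((hs _ ⟨a, rfl⟩).1).symm⟩
  exact H

/-- The GNS representation, as a ring homomorphism into the enveloping von Neumann algebra. -/
noncomputable def gnsToVN : A →+* envelopingVN h :=
  (h.gnsStarAlgHom : A →+* (h.GNS →L[ℂ] h.GNS)).codRestrict (envelopingVN h)
    (gns_mem_envelopingVN h)

/-- The canonical extension of `h` to the enveloping von Neumann algebra, the vector functional
of the class of `1` in the GNS space. -/
noncomputable def vnTrace (x : envelopingVN h) : ℂ :=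
  ⟪((h.toPreGNS 1 : h.PreGNS) : h.GNS), (x : h.GNS →L[ℂ] h.GNS) (h.toPreGNS 1 : h.PreGNS)⟫_ℂ

end Enveloping

/-! ## Tor over a noncommutative ring, with the left module structure of the coefficients

For a ring homomorphism `φ : R → M` the ring `M` is an `M`-`R`-bimodule.  `balancedTensor φ X` is
`M ⊗_R X` with its left `M`-module structure, and `torFunctor φ n` is `Tor_n^R(M, -)`, the `n`-th
left derived functor of `M ⊗_R -`, with values in left `M`-modules. -/

section Tor

variable {R M : Type u} [Ring R] [Ring M] (φ : R →+* M)

/-- The submodule of `M ⊗_ℤ X` generated by the elements `mφ(r) ⊗ x - m ⊗ rx`. -/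
def balancedRelations (X : Type u) [AddCommGroup X] [Module R X] : Submodule M (M ⊗[ℤ] X) :=
  Submodule.span M {t | ∃ (m : M) (r : R) (x : X),
    t = (m * φ r) ⊗ₜ[ℤ] x - m ⊗ₜ[ℤ] (r • x)}

theorem balancedRelations_le_comap {X Y : Type u} [AddCommGroup X] [Module R X]
    [AddCommGroup Y] [Module R Y] (f : X →ₗ[R] Y) :
    balancedRelations φ X ≤ (balancedRelations φ Y).comap
      (TensorProduct.AlgebraTensorModule.lTensor M M (f.toAddMonoidHom.toIntLinearMap)) := by
  refine Submodule.span_le.2 ?_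
  rintro _ ⟨m, r, x, rfl⟩
  refine Submodule.subset_span ⟨m, r, f x, ?_⟩
  simp

/-- The functor `X ↦ M ⊗_R X` from left `R`-modules to left `M`-modules. -/
noncomputable def balancedTensor : ModuleCat.{u} R ⥤ ModuleCat.{u} M where
  obj X := ModuleCat.of M ((M ⊗[ℤ] X) ⧸ balancedRelations φ X)
  map {X Y} f := ModuleCat.ofHom (Submodule.mapQ _ _ _ (balancedRelations_le_comap φ f.hom))
  map_id X := by
    apply ModuleCat.hom_ext
    apply Submodule.linearMap_qext
    apply TensorProduct.AlgebraTensorModule.ext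
    intro m x
    simp
  map_comp f g := by
    apply ModuleCat.hom_ext
    apply Submodule.linearMap_qext
    apply TensorProduct.AlgebraTensorModule.ext
    intro m x
    simp

instance balancedTensor_additive : (balancedTensor φ).Additive where
  map_add {X Y f g} := by
    apply ModuleCat.hom_ext
    apply Submodule.linearMap_qext
    apply TensorProduct.AlgebraTensorModule.ext
    intro m x
    change Submodule.Quotient.mk (p := balancedRelations φ Y) (m ⊗ₜ[ℤ] (f.hom x + g.hom x)) =
      Submodule.Quotient.mk (p := balancedRelations φ Y) (m ⊗ₜ[ℤ] f.hom x) +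
        Submodule.Quotient.mk (p := balancedRelations φ Y) (m ⊗ₜ[ℤ] g.hom x)
    rw [TensorProduct.tmul_add, Submodule.Quotient.mk_add]

/-- `Tor_n^R(M, -)` with values in left `M`-modules. -/
noncomputable def torFunctor (n : ℕ) : ModuleCat.{u} R ⥤ ModuleCat.{u} M :=
  (balancedTensor φ).leftDerived n

end Tor

/-! ## Lück's extended dimension function and capacities

Here `M` is a finite von Neumann algebra with trace `τ`.  Left `M`-modules are used throughout;
an `m × n` matrix acts on row vectors by right multiplication, `M^m → M^n`. -/

section Invariants

variable {M : Type u} [Ring M] [StarRing M] (τ : M → ℂ)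

/-- `P` is a finitely generated projective left module, isomorphic to `M^n e` for an idempotent
matrix `e`, and `d` is the trace of `e`; so `d` is the von Neumann dimension of `P`. -/
def HasProjectiveDim (P : Type u) [AddCommGroup P] [Module M P] (d : ℝ) : Prop :=
  ∃ (n : ℕ) (e : Matrix (Fin n) (Fin n) M), e * e = e ∧
    Nonempty (P ≃ₗ[M] LinearMap.range e.vecMulLinear) ∧ d = (∑ i, τ (e i i)).re

/-- The extended dimension of an arbitrary left module: the supremum of the dimensions of its
finitely generated projective submodules. -/
noncomputable def extendedDim (Q : Type u) [AddCommGroup Q] [Module M Q] : ℝ≥0∞ :=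
  ⨆ (P : Submodule M Q) (d : ℝ) (_ : HasProjectiveDim τ P d), ENNReal.ofReal d

/-- The square of the `L²`-norm of a row vector. -/
noncomputable def l2NormSq {n : ℕ} (x : Fin n → M) : ℝ := ∑ i, (τ (star (x i) * x i)).re

/-- The spectral density function of `f : M^m → M^n` at `l`: the supremum of the dimensions of the
Hilbert submodules `L²(M)^m p` (with `p` a projection) on which `‖x f‖ ≤ l ‖x‖`; the inequality
is tested on the dense subspace `M^m p`. -/
noncomputable def spectralDensity {m n : ℕ} (f : Matrix (Fin m) (Fin n) M) (l : ℝ) : ℝ :=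
  sSup {d | ∃ p : Matrix (Fin m) (Fin m) M, p * p = p ∧ p.conjTranspose = p ∧
    (∀ x : Fin m → M, l2NormSq τ (Matrix.vecMul (Matrix.vecMul x p) f) ≤
      l ^ 2 * l2NormSq τ (Matrix.vecMul x p)) ∧
    d = (∑ i, τ (p i i)).re}

/-- Capacities take values in `{0⁻} ∪ [0, ∞]`, where the new element `0⁻ = ⊥` lies below `0`. -/
abbrev Capacity : Type := WithBot ℝ≥0∞

open Classical in
/-- The inverse of the Novikov-Shubin invariant of `f : M^m → M^n`.  The Novikov-Shubin invariant
is `liminf_{l → 0+} log (F(l) - F(0)) / log l` when `F(l) > F(0)` for all `l > 0`, where `F` is the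
spectral density function, and is `∞⁺` otherwise; the inverse of `∞⁺` is `0⁻`. -/
noncomputable def matrixCapacity {m n : ℕ} (f : Matrix (Fin m) (Fin n) M) : Capacity :=
  if ∀ l : ℝ, 0 < l → spectralDensity τ f 0 < spectralDensity τ f l then
    (((Filter.liminf (fun l : ℝ => ENNReal.ofReal
      (Real.log (spectralDensity τ f l - spectralDensity τ f 0) / Real.log l)) (𝓝[>] 0))⁻¹ :
        ℝ≥0∞) : Capacity)
  else ⊥

/-- The finitely presented module presented by the matrix `f`, the cokernel of `M^m → M^n`. -/
abbrev Presented {m n : ℕ} (f : Matrix (Fin m) (Fin n) M) : Type u :=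
  (Fin n → M) ⧸ LinearMap.range f.vecMulLinear

/-- The module presented by `f` has dimension zero and surjects onto `N`. -/
def IsZeroDimCover (N : Type u) [AddCommGroup N] [Module M N] {m n : ℕ}
    (f : Matrix (Fin m) (Fin n) M) : Prop :=
  extendedDim τ (Presented f) = 0 ∧
    ∃ q : Presented f →ₗ[M] N, Function.Surjective q

/-- A module is measurable if it is a quotient of a finitely presented zero-dimensional module. -/
def IsMeasurableModule (N : Type u) [AddCommGroup N] [Module M N] : Prop :=
  ∃ (m n : ℕ) (f : Matrix (Fin m) (Fin n) M), IsZeroDimCover τ N f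

/-- The capacity of a measurable module: the infimum of the capacities of the finitely presented
zero-dimensional modules of which it is a quotient. -/
noncomputable def measurableCapacity (N : Type u) [AddCommGroup N] [Module M N] : Capacity :=
  ⨅ (m : ℕ) (n : ℕ) (f : Matrix (Fin m) (Fin n) M) (_ : IsZeroDimCover τ N f), matrixCapacity τ f

/-- A module is cofinal-measurable if all its finitely generated submodules are measurable. -/
def IsCofinalMeasurable (Q : Type u) [AddCommGroup Q] [Module M Q] : Prop :=
  ∀ N : Submodule M Q, N.FG → IsMeasurableModule τ N

/-- The capacity of a cofinal-measurable module: the supremum of the capacities of its finitely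
generated submodules. -/
noncomputable def cofinalCapacity (Q : Type u) [AddCommGroup Q] [Module M Q] : Capacity :=
  ⨆ (N : Submodule M Q) (_ : N.FG), measurableCapacity τ N

/-- The capacity of an arbitrary module: the supremum of the capacities of its cofinal-measurable
submodules. -/
noncomputable def capacity (Q : Type u) [AddCommGroup Q] [Module M Q] : Capacity :=
  ⨆ (T : Submodule M Q) (_ : IsCofinalMeasurable τ T), cofinalCapacity τ T

end Invariants

/-! ## `L²`-homology, `L²`-Betti numbers and capacities of a quantum group -/

namespace CompactQuantumGroup

variable {A : Type u} [CStarAlgebra A] [FiniteDimensional ℂ A] (G : CompactQuantumGroup A)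

/-- The field `ℂ` viewed as a left `A₀`-module through a character `ε`. -/
noncomputable def counitModule (ε : G.coeffAlgebra →ₐ[ℂ] ℂ) : ModuleCat.{u} G.coeffAlgebra :=
  letI : Module G.coeffAlgebra (ULift.{u} ℂ) := Module.compHom _ (ε : G.coeffAlgebra →+* ℂ)
  ModuleCat.of G.coeffAlgebra (ULift.{u} ℂ)

variable [PartialOrder A] [StarOrderedRing A] (h : A →ₚ[ℂ] ℂ) (ε : G.coeffAlgebra →ₐ[ℂ] ℂ)

/-- The `n`-th `L²`-homology `Tor_n^{A₀}(π_h(A)'', ℂ)`, a left `π_h(A)''`-module. -/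
noncomputable def l2Homology (n : ℕ) : ModuleCat.{u} (envelopingVN h) :=
  (torFunctor ((gnsToVN h).comp (G.coeffAlgebra.val : G.coeffAlgebra →+* A)) n).obj
    (G.counitModule ε)

/-- The `n`-th `L²`-Betti number. -/
noncomputable def l2Betti (n : ℕ) : ℝ≥0∞ := extendedDim (vnTrace h) (G.l2Homology h ε n)

/-- The `n`-th capacity. -/
noncomputable def nthCapacity (n : ℕ) : Capacity := capacity (vnTrace h) (G.l2Homology h ε n)

end CompactQuantumGroup

/-!
The Haar state turns out to be the normalized character of the regular representation,
`h(a) = Tr(L_a) / N` (`regularState`). This is a trace by construction, and it is positive and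
faithful because the eigenvalues of `L_a` form the spectrum of `a`. The canonical map
`a ⊗ b ↦ Δ(b) (a ⊗ 1)` is bijective by cancellation and turns `1 ⊗ L_a` into `L_{Δ(a)}`; taking
traces gives `(h ⊗ h) Δ = h` (`CompactQuantumGroup.regularState_slice_comul`). For a faithful state
this idempotence already implies invariance: with `E = (id ⊗ h) Δ` the element
`Δ(E a) - E a ⊗ 1` has norm zero in `L²(h ⊗ h)`, so `(id ⊗ E) Δ(a) = E a ⊗ 1`, and density forces
`E` to be scalar valued (`CompactQuantumGroup.exists_eq_algebraMap_of_lTensor_comul`).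

Slicing `Δ` along an `h`-orthonormal basis of `A` gives a unitary corepresentation whose
coefficients span `A`, so `A₀ = A`; unitarity also yields right invariance. The counit is obtained
from the inverse of the other canonical map `a ⊗ b ↦ Δ(a) (1 ⊗ b)` (`exists_right_counit`).

As `h` is faithful, `A` is its own GNS space and `π_h(A)'' = π_h(A)`. Representing the counit by
the trace form, `ε = N h(· p)`, produces an idempotent `p` with `a p = ε(a) p` and `h(p) = 1 / N`
(`exists_idempotent_of_character`). Therefore the trivial module `ℂ ≅ A p` is projective, the higher
`Tor` modules vanish, and `Tor₀ ≅ M p` is a simple projective module of dimension `1 / N`. A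
projective module of positive dimension cannot be a quotient of a zero-dimensional one, because the
surjection would split; hence all measurable submodules of the homology are zero, and its capacity
is `0⁻`.
-/

/-! ### Slice maps -/

section Slice
variable {A : Type u} [Ring A] [Algebra ℂ A]

/-- The slice map `id ⊗ f`. -/
noncomputable def slice (f : A →ₗ[ℂ] ℂ) : A ⊗[ℂ] A →ₗ[ℂ] A :=
  (TensorProduct.rid ℂ A).toLinearMap ∘ₗ f.lTensor A

@[simp]
theorem slice_tmul (f : A →ₗ[ℂ] ℂ) (a b : A) : slice f (a ⊗ₜ[ℂ] b) = f b • a := by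
  simp [slice]

theorem slice_tmul_one_mul (f : A →ₗ[ℂ] ℂ) (c : A) (X : A ⊗[ℂ] A) :
    slice f ((c ⊗ₜ[ℂ] (1 : A)) * X) = c * slice f X := by
  induction X with
  | zero => simp
  | tmul x y => simp
  | add X Y hX hY => simp only [mul_add, map_add, hX, hY]

theorem slice_mul_tmul_one (f : A →ₗ[ℂ] ℂ) (c : A) (X : A ⊗[ℂ] A) :
    slice f (X * (c ⊗ₜ[ℂ] (1 : A))) = slice f X * c := by
  induction X with
  | zero => simp
  | tmul x y => simp
  | add X Y hX hY => simp only [add_mul, map_add, hX, hY]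

theorem slice_mul_one_tmul (f : A →ₗ[ℂ] ℂ) (c : A) (X : A ⊗[ℂ] A) :
    slice f (X * ((1 : A) ⊗ₜ[ℂ] c)) = slice (f ∘ₗ LinearMap.mulRight ℂ c) X := by
  induction X with
  | zero => simp
  | tmul x y => simp
  | add X Y hX hY => simp only [add_mul, map_add, hX, hY]

theorem sum_slice_coord {ι : Type*} [Fintype ι] (b : Module.Basis ι ℂ A) (X : A ⊗[ℂ] A) :
    ∑ i, slice (b.coord i) X ⊗ₜ[ℂ] b i = X := by
  induction X with
  | zero => simp
  | tmul x y =>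
    simp only [slice_tmul, TensorProduct.smul_tmul, ← TensorProduct.tmul_sum]
    congr 1
    exact b.sum_repr y
  | add X Y hX hY => simp only [map_add, TensorProduct.add_tmul, Finset.sum_add_distrib, hX, hY]

end Slice

/-! ### The trace of the regular representation -/

section RegularTrace

/-- The character of the regular representation, `a ↦ Tr (x ↦ a x)`. -/
noncomputable def regularTrace (A : Type u) [Ring A] [Algebra ℂ A] : A →ₗ[ℂ] ℂ :=
  LinearMap.trace ℂ A ∘ₗ (Algebra.lmul ℂ A).toLinearMap

section
variable {A : Type u} [Ring A] [Algebra ℂ A]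

theorem regularTrace_apply (a : A) :
    regularTrace A a = LinearMap.trace ℂ A (Algebra.lmul ℂ A a) := rfl

theorem regularTrace_mul_comm (a b : A) :
    regularTrace A (a * b) = regularTrace A (b * a) := by
  simp only [regularTrace_apply, map_mul]
  exact LinearMap.trace_mul_comm _ _ _

variable [FiniteDimensional ℂ A]

theorem regularTrace_one : regularTrace A 1 = Module.finrank ℂ A := by
  rw [regularTrace_apply, map_one, LinearMap.trace_one]

theorem regularTrace_tensor (X : A ⊗[ℂ] A) :
    regularTrace (A ⊗[ℂ] A) X = regularTrace A (slice (regularTrace A) X) := by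
  induction X with
  | zero => simp
  | tmul x y =>
    rw [slice_tmul, map_smul, smul_eq_mul, regularTrace_apply, regularTrace_apply,
      regularTrace_apply, mul_comm, ← LinearMap.trace_tensorProduct']
    congr 1
    ext a b
    simp
  | add X Y hX hY => simp only [map_add, hX, hY]

theorem isRoot_charpoly_lmul (a : A) (z : ℂ) :
    (Algebra.lmul ℂ A a : Module.End ℂ A).charpoly.IsRoot z ↔ z ∈ spectrum ℂ a := by
  rw [← Module.End.mem_spectrum_iff_isRoot_charpoly, spectrum.mem_iff, spectrum.mem_iff,
    ← (Algebra.lmul ℂ A).commutes, ← map_sub, not_iff_not]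
  exact Algebra.lmul_isUnit_iff

theorem regularTrace_eq_sum_roots (a : A) :
    regularTrace A a = (Algebra.lmul ℂ A a : Module.End ℂ A).charpoly.roots.sum :=
  Module.End.trace_eq_sum_roots_charpoly_of_splits (IsAlgClosed.splits _)

end

variable {A : Type u} [CStarAlgebra A] [FiniteDimensional ℂ A] [PartialOrder A] [StarOrderedRing A]

theorem regularTrace_nonneg {a : A} (ha : 0 ≤ a) : 0 ≤ regularTrace A a := by
  rw [regularTrace_eq_sum_roots]
  refine Multiset.sum_nonneg fun z hz => ?_
  exact spectrum_nonneg_of_nonneg ha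
    ((isRoot_charpoly_lmul a z).1 (Polynomial.isRoot_of_mem_roots hz))

/-- A positive element of trace zero has spectrum `{0}`, since its eigenvalues in the regular
representation are nonnegative with sum zero. -/
theorem eq_zero_of_regularTrace_eq_zero {a : A} (ha : 0 ≤ a) (h : regularTrace A a = 0) :
    a = 0 := by
  rw [regularTrace_eq_sum_roots] at h
  have hnn : ∀ z ∈ (Algebra.lmul ℂ A a : Module.End ℂ A).charpoly.roots, 0 ≤ z := fun z hz =>
    spectrum_nonneg_of_nonneg ha
      ((isRoot_charpoly_lmul a z).1 (Polynomial.isRoot_of_mem_roots hz))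
  have hz : ∀ z ∈ spectrum ℂ a, z = 0 := fun z hz =>
    Multiset.all_zero_of_le_zero_le_of_sum_eq_zero hnn h _ ((Polynomial.mem_roots
      (LinearMap.charpoly_monic _).ne_zero).2 ((isRoot_charpoly_lmul a z).2 hz))
  have hs : IsStarNormal a := (IsSelfAdjoint.of_nonneg ha).isStarNormal
  exact CFC.eq_zero_of_spectrum_subset_zero (R := ℂ) a hz hs

/-- The normalized character of the regular representation. It turns out to be the Haar state of
every compact quantum group structure on `A`. -/
noncomputable def regularState (A : Type u) [CStarAlgebra A] [FiniteDimensional ℂ A]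
    [PartialOrder A] [StarOrderedRing A] : A →ₚ[ℂ] ℂ :=
  PositiveLinearMap.mk₀ ((Module.finrank ℂ A : ℂ)⁻¹ • regularTrace A) fun a ha =>
    mul_nonneg (by positivity) (regularTrace_nonneg ha)

theorem regularState_apply (a : A) :
    regularState A a = (Module.finrank ℂ A : ℂ)⁻¹ * regularTrace A a := rfl

theorem regularState_mul_comm (a b : A) : regularState A (a * b) = regularState A (b * a) := by
  simp only [regularState_apply, regularTrace_mul_comm]

theorem regularState_one [Nontrivial A] : regularState A 1 = 1 := by
  rw [regularState_apply, regularTrace_one]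
  exact inv_mul_cancel₀ (Nat.cast_ne_zero.2 Module.finrank_pos.ne')

theorem regularState_faithful [Nontrivial A] {a : A} (h : regularState A (star a * a) = 0) :
    a = 0 := by
  have hN : ((Module.finrank ℂ A : ℂ)⁻¹) ≠ 0 :=
    inv_ne_zero (Nat.cast_ne_zero.2 Module.finrank_pos.ne')
  exact CStarRing.star_mul_self_eq_zero_iff a |>.1 (eq_zero_of_regularTrace_eq_zero
    (star_mul_self_nonneg a) ((mul_eq_zero.1 h).resolve_left hN))

end RegularTrace

/-! ### Canonical maps and convolution idempotence -/

namespace CompactQuantumGroup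
variable {A : Type u} [CStarAlgebra A] [FiniteDimensional ℂ A] (G : CompactQuantumGroup A)

theorem mem_span_comul_mul_left (X : A ⊗[ℂ] A) :
    X ∈ Submodule.span ℂ {x | ∃ a b : A, x = G.comul b * (a ⊗ₜ[ℂ] (1 : A))} := by
  rw [G.span_comul_mul_left]; trivial

/-- The canonical map `a ⊗ b ↦ Δ(b) (a ⊗ 1)`. -/
noncomputable def leftCanonical : A ⊗[ℂ] A →ₗ[ℂ] A ⊗[ℂ] A :=
  LinearMap.mul' ℂ (A ⊗[ℂ] A) ∘ₗ TensorProduct.map G.comul.toAlgHom.toLinearMap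
    (Algebra.TensorProduct.includeLeft : A →ₐ[ℂ] A ⊗[ℂ] A).toLinearMap ∘ₗ
    (TensorProduct.comm ℂ A A).toLinearMap

theorem leftCanonical_tmul (a b : A) :
    G.leftCanonical (a ⊗ₜ[ℂ] b) = G.comul b * (a ⊗ₜ[ℂ] (1 : A)) := by
  simp [leftCanonical]

theorem leftCanonical_bijective : Function.Bijective G.leftCanonical := by
  have hs : Function.Surjective G.leftCanonical := by
    rw [← LinearMap.range_eq_top, eq_top_iff, ← G.span_comul_mul_left, Submodule.span_le]
    rintro _ ⟨a, b, rfl⟩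
    exact ⟨a ⊗ₜ b, G.leftCanonical_tmul a b⟩
  exact ⟨LinearMap.injective_iff_surjective.2 hs, hs⟩

/-- The canonical map `a ⊗ b ↦ Δ(a) (1 ⊗ b)`. -/
noncomputable def rightCanonical : A ⊗[ℂ] A →ₗ[ℂ] A ⊗[ℂ] A :=
  LinearMap.mul' ℂ (A ⊗[ℂ] A) ∘ₗ TensorProduct.map G.comul.toAlgHom.toLinearMap
    (Algebra.TensorProduct.includeRight : A →ₐ[ℂ] A ⊗[ℂ] A).toLinearMap

theorem rightCanonical_tmul (a b : A) :
    G.rightCanonical (a ⊗ₜ[ℂ] b) = G.comul a * ((1 : A) ⊗ₜ[ℂ] b) := by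
  simp [rightCanonical]

theorem rightCanonical_bijective : Function.Bijective G.rightCanonical := by
  have hs : Function.Surjective G.rightCanonical := by
    rw [← LinearMap.range_eq_top, eq_top_iff, ← G.span_comul_mul_right, Submodule.span_le]
    rintro _ ⟨a, b, rfl⟩
    exact ⟨b ⊗ₜ a, G.rightCanonical_tmul b a⟩
  exact ⟨LinearMap.injective_iff_surjective.2 hs, hs⟩

/-- The intertwining property behind the invariance of the regular character: conjugation by the
canonical map turns the regular representation of `A ⊗ A`, restricted along `Δ`, into a multiple of
the regular representation of `A`. -/
theorem regularTrace_slice_comul (a : A) :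
    regularTrace A (slice (regularTrace A) (G.comul a)) =
      Module.finrank ℂ A * regularTrace A a := by
  let T := LinearEquiv.ofBijective _ G.leftCanonical_bijective
  have hT : ∀ X, T X = G.leftCanonical X := fun _ => rfl
  have key : (Algebra.lmul ℂ (A ⊗[ℂ] A) (G.comul a) : Module.End ℂ (A ⊗[ℂ] A)) =
      T.conj (TensorProduct.map LinearMap.id (Algebra.lmul ℂ A a)) := by
    have h2 : (Algebra.lmul ℂ (A ⊗[ℂ] A) (G.comul a)) ∘ₗ G.leftCanonical =
        G.leftCanonical ∘ₗ (TensorProduct.map LinearMap.id (Algebra.lmul ℂ A a)) := by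
      ext x y
      simp [leftCanonical_tmul, mul_assoc]
    refine LinearMap.ext fun X => ?_
    obtain ⟨Y, rfl⟩ := T.surjective X
    rw [LinearEquiv.conj_apply_apply, T.symm_apply_apply, hT, hT]
    exact LinearMap.congr_fun h2 Y
  rw [← regularTrace_tensor, regularTrace_apply, key, LinearMap.trace_conj',
    LinearMap.trace_tensorProduct', LinearMap.trace_id, regularTrace_apply]

/-- A linear map `E` with `(id ⊗ E) Δ(a) ∈ A ⊗ 1` for all `a` takes scalar values: by density
`(id ⊗ E) (1 ⊗ x) = 1 ⊗ E x` also lies in `A ⊗ 1`. -/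
theorem exists_eq_algebraMap_of_lTensor_comul [Nontrivial A] (E D : A →ₗ[ℂ] A)
    (h : ∀ a, E.lTensor A (G.comul a) = D a ⊗ₜ[ℂ] (1 : A)) (x : A) :
    ∃ c : ℂ, E x = algebraMap ℂ A c := by
  have hmul : ∀ (X : A ⊗[ℂ] A) (c : A), E.lTensor A (X * (c ⊗ₜ[ℂ] (1 : A))) =
      E.lTensor A X * (c ⊗ₜ[ℂ] (1 : A)) := fun X c => by
    induction X with
    | zero => simp
    | tmul x y => simp
    | add X Y hX hY => simp only [add_mul, map_add, hX, hY]
  have key : ∀ X : A ⊗[ℂ] A, ∃ y : A, E.lTensor A X = y ⊗ₜ[ℂ] (1 : A) := fun X => by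
    induction G.mem_span_comul_mul_left X using Submodule.span_induction with
    | mem _ hx =>
      obtain ⟨a, b, rfl⟩ := hx
      exact ⟨D b * a, by simp [hmul, h]⟩
    | zero => exact ⟨0, by simp⟩
    | add X Y _ _ hX hY =>
      obtain ⟨x, hx⟩ := hX
      obtain ⟨y, hy⟩ := hY
      exact ⟨x + y, by rw [map_add, hx, hy, TensorProduct.add_tmul]⟩
    | smul c X _ hX =>
      obtain ⟨x, hx⟩ := hX
      exact ⟨c • x, by rw [map_smul, hx, TensorProduct.smul_tmul']⟩
  obtain ⟨f, hf⟩ := SeparatingDual.exists_eq_one (R := ℂ) (one_ne_zero : (1 : A) ≠ 0)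
  obtain ⟨y, hy⟩ := key (1 ⊗ₜ x)
  have := congrArg (TensorProduct.lid ℂ A ∘ (f : A →ₗ[ℂ] ℂ).rTensor A) hy
  refine ⟨f y, ?_⟩
  simpa [hf, Algebra.algebraMap_eq_smul_one] using this

variable [PartialOrder A] [StarOrderedRing A]

/-- The regular state is idempotent under convolution. -/
theorem regularState_slice_comul [Nontrivial A] (a : A) :
    regularState A (slice (regularState A).toLinearMap (G.comul a)) = regularState A a := by
  have hN : (Module.finrank ℂ A : ℂ) ≠ 0 := Nat.cast_ne_zero.2 Module.finrank_pos.ne'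
  have h1 : slice (regularState A).toLinearMap =
      (Module.finrank ℂ A : ℂ)⁻¹ • slice (regularTrace A) := by
    ext x y
    simp [regularState_apply, mul_smul]
  rw [h1, LinearMap.smul_apply, map_smul, regularState_apply, G.regularTrace_slice_comul,
    regularState_apply, inv_mul_cancel_left₀ hN, smul_eq_mul]

end CompactQuantumGroup

/-! ### The GNS space of a faithful functional -/

section GNS
variable {A : Type u} [CStarAlgebra A] [PartialOrder A] [StarOrderedRing A] (h : A →ₚ[ℂ] ℂ)

/-- The canonical map from `A` to the GNS space, `a ↦ [a]`. -/
noncomputable def toGNS : A →ₗ[ℂ] h.GNS :=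
  (UniformSpace.Completion.toComplₗᵢ (𝕜 := ℂ) (E := h.PreGNS)).toLinearMap ∘ₗ
    h.toPreGNS.toLinearMap

theorem toGNS_apply (a : A) : toGNS h a = ((h.toPreGNS a : h.PreGNS) : h.GNS) := rfl

theorem inner_toGNS (a b : A) : ⟪toGNS h a, toGNS h b⟫_ℂ = h (star a * b) := by
  rw [toGNS_apply, toGNS_apply, UniformSpace.Completion.inner_coe, h.preGNS_inner_def]
  rfl

theorem gnsStarAlgHom_toGNS (a b : A) : h.gnsStarAlgHom a (toGNS h b) = toGNS h (a * b) := by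
  rw [toGNS_apply, toGNS_apply]
  simp

variable {h} in
theorem toGNS_injective (hf : ∀ a, h (star a * a) = 0 → a = 0) :
    Function.Injective (toGNS h) := by
  rw [injective_iff_map_eq_zero]
  intro a ha
  apply hf
  rw [← inner_toGNS, ha, inner_zero_left]

variable [FiniteDimensional ℂ A]

/-- The range of `a ↦ [a]` is dense, and closed because it is finite dimensional. -/
theorem toGNS_surjective : Function.Surjective (toGNS h) := by
  have hc : IsClosed ((LinearMap.range (toGNS h) : Submodule ℂ h.GNS) : Set h.GNS) :=
    Submodule.closed_of_finiteDimensional _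
  have hd : DenseRange (toGNS h) :=
    UniformSpace.Completion.denseRange_coe.comp h.toPreGNS.surjective.denseRange
      (UniformSpace.Completion.continuous_coe _)
  intro x
  have : x ∈ closure (Set.range (toGNS h)) := hd x
  rw [← LinearMap.coe_range, hc.closure_eq] at this
  exact this

/-- The GNS space of a faithful functional on a finite dimensional algebra is the algebra. -/
noncomputable def equivGNS (hf : ∀ a, h (star a * a) = 0 → a = 0) : A ≃ₗ[ℂ] h.GNS :=
  LinearEquiv.ofBijective (toGNS h) ⟨toGNS_injective hf, toGNS_surjective h⟩

variable {h} in
theorem exists_orthonormal_basis (hf : ∀ a, h (star a * a) = 0 → a = 0) :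
    ∃ (n : ℕ) (b : Module.Basis (Fin n) ℂ A),
      ∀ i j, h (star (b i) * b j) = if i = j then 1 else 0 := by
  have : FiniteDimensional ℂ h.GNS := (equivGNS h hf).finiteDimensional
  refine ⟨_, (stdOrthonormalBasis ℂ h.GNS).toBasis.map (equivGNS h hf).symm, fun i j => ?_⟩
  have : ∀ x, toGNS h ((equivGNS h hf).symm x) = x := (equivGNS h hf).apply_symm_apply
  rw [← inner_toGNS, Module.Basis.map_apply, Module.Basis.map_apply, this, this,
    OrthonormalBasis.coe_toBasis]
  exact orthonormal_iff_ite.1 (stdOrthonormalBasis ℂ h.GNS).orthonormal i j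

variable {h} in
/-- The product functional `h ⊗ h` of a faithful functional with itself is faithful. -/
theorem eq_zero_of_slice_star_mul_self (hf : ∀ a, h (star a * a) = 0 → a = 0) {X : A ⊗[ℂ] A}
    (hX : h (slice h.toLinearMap (star X * X)) = 0) : X = 0 := by
  obtain ⟨n, b, hb⟩ := exists_orthonormal_basis hf
  obtain ⟨y, rfl⟩ : ∃ y : Fin n → A, X = ∑ i, y i ⊗ₜ[ℂ] b i := ⟨_, (sum_slice_coord b X).symm⟩
  have h1 : h (slice h.toLinearMap (star (∑ i, y i ⊗ₜ[ℂ] b i) * ∑ i, y i ⊗ₜ[ℂ] b i)) =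
      ∑ i, h (star (y i) * y i) := by
    simp [Finset.sum_mul, Finset.mul_sum, star_sum, hb]
  rw [h1, Finset.sum_eq_zero_iff_of_nonneg
    fun i _ => h.map_nonneg (star_mul_self_nonneg _)] at hX
  exact Finset.sum_eq_zero fun i hi => by rw [hf _ (hX i hi), TensorProduct.zero_tmul]

end GNS

/-! ### Left invariance -/

namespace CompactQuantumGroup
variable {A : Type u} [CStarAlgebra A] [FiniteDimensional ℂ A] (G : CompactQuantumGroup A)

theorem coassoc_apply (a : A) :
    TensorProduct.assoc ℂ A A A (G.comul.toAlgHom.toLinearMap.rTensor A (G.comul a)) =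
      G.comul.toAlgHom.toLinearMap.lTensor A (G.comul a) :=
  LinearMap.congr_fun G.coassoc a

/-- Coassociativity, with the last leg evaluated at `f`. -/
theorem comul_slice_comul (f : A →ₗ[ℂ] ℂ) (a : A) :
    G.comul (slice f (G.comul a)) =
      (slice f ∘ₗ G.comul.toAlgHom.toLinearMap).lTensor A (G.comul a) := by
  have h1 : ∀ X : A ⊗[ℂ] A, (slice f).lTensor A (TensorProduct.assoc ℂ A A A
      (G.comul.toAlgHom.toLinearMap.rTensor A X)) = G.comul (slice f X) := fun X => by
    induction X with
    | zero => simp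
    | tmul x y =>
      simp only [LinearMap.rTensor_tmul, slice_tmul, map_smul, AlgHom.toLinearMap_apply,
        StarAlgHom.coe_toAlgHom]
      induction G.comul x with
      | zero => simp
      | tmul u v => simp
      | add X Y hX hY => simp only [map_add, TensorProduct.add_tmul, smul_add, hX, hY]
    | add X Y hX hY => simp only [map_add, hX, hY]
  rw [← h1, coassoc_apply, LinearMap.lTensor_comp_apply]

variable [PartialOrder A] [StarOrderedRing A] [Nontrivial A]

/-- Left invariance of the regular state. -/
theorem slice_comul_regularState (a : A) :
    slice (regularState A).toLinearMap (G.comul a) = algebraMap ℂ A (regularState A a) := by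
  set h := regularState A with hh
  have hf : ∀ a, h (star a * a) = 0 → a = 0 := fun a => regularState_faithful
  let E : A →ₗ[ℂ] A := slice h.toLinearMap ∘ₗ G.comul.toAlgHom.toLinearMap
  have hE : ∀ a, E a = slice h.toLinearMap (G.comul a) := fun _ => rfl
  have hhE : ∀ a, h (E a) = h a := G.regularState_slice_comul
  have hEE : ∀ a, E (E a) = E a := fun a => by
    rw [hE, hE, comul_slice_comul]
    change (slice h.toLinearMap ∘ₗ E.lTensor A) _ = _
    congr 1
    ext x y
    simpa using congrArg (· • x) (hhE y)
  have hstar : ∀ X : A ⊗[ℂ] A, slice h.toLinearMap (star X) = star (slice h.toLinearMap X) :=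
    fun X => by
    induction X with
    | zero => simp
    | tmul x y => simp [map_star]
    | add X Y hX hY => simp only [map_add, star_add, hX, hY]
  -- the Cauchy–Schwarz argument: the vectors `Δ(E a)` and `E a ⊗ 1` have distance zero
  have hΔ : ∀ a, G.comul (E a) = E a ⊗ₜ[ℂ] (1 : A) := fun a => by
    rw [← sub_eq_zero]
    apply eq_zero_of_slice_star_mul_self hf
    set b := E a with hb
    have hbb : E b = b := hEE a
    have e1 : star (b ⊗ₜ[ℂ] (1 : A)) = star b ⊗ₜ[ℂ] (1 : A) := by simp
    have h1 : h.toLinearMap 1 = 1 := regularState_one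
    have hbs : E (star b) = star b := by rw [hE, map_star, hstar, ← hE, hbb]
    rw [star_sub, sub_mul, mul_sub, mul_sub, e1]
    simp only [map_sub, slice_tmul_one_mul, slice_mul_tmul_one, ← map_star, ← map_mul,
      ← hE, hbb, hbs, slice_tmul, h1, one_smul, hhE]
    simp
  obtain ⟨c, hc⟩ := G.exists_eq_algebraMap_of_lTensor_comul E E (fun a => by
    rw [← hΔ, hE, comul_slice_comul]) a
  have := hhE a
  rw [hc, Algebra.algebraMap_eq_smul_one, map_smul, regularState_one, smul_eq_mul, mul_one] at this
  rw [← hE, hc, this]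

end CompactQuantumGroup

/-! ### The regular corepresentation, the coefficient algebra and the Haar state -/

namespace CompactQuantumGroup
variable {A : Type u} [CStarAlgebra A] [FiniteDimensional ℂ A] (G : CompactQuantumGroup A)

/-- The matrix of the regular corepresentation in the basis `b`, with
`Δ(b j) = ∑ i, w j i ⊗ b i`. -/
noncomputable def regularCorep {ι : Type} (b : Module.Basis ι ℂ A) : Matrix ι ι A :=
  Matrix.of fun j i => slice (b.coord i) (G.comul (b j))

section
variable {ι : Type} [Fintype ι] (b : Module.Basis ι ℂ A)

theorem comul_basis (j : ι) : G.comul (b j) = ∑ i, G.regularCorep b j i ⊗ₜ[ℂ] b i :=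
  (sum_slice_coord b _).symm

theorem comul_regularCorep (j i : ι) :
    G.comul (G.regularCorep b j i) = ∑ k, G.regularCorep b j k ⊗ₜ[ℂ] G.regularCorep b k i := by
  change G.comul (slice _ _) = _
  rw [comul_slice_comul]
  conv_lhs => rw [comul_basis]
  simp only [map_sum, LinearMap.lTensor_tmul]
  rfl

/-- The coefficients span all slices of `Δ(A) (1 ⊗ A)`, which is `A ⊗ A`. -/
theorem span_regularCorep :
    Submodule.span ℂ (Set.range fun p : ι × ι => G.regularCorep b p.1 p.2) = ⊤ := by
  set S := Submodule.span ℂ (Set.range fun p : ι × ι => G.regularCorep b p.1 p.2)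
  have hS : ∀ j i, G.regularCorep b j i ∈ S := fun j i => Submodule.subset_span ⟨(j, i), rfl⟩
  have h1 : ∀ (f : A →ₗ[ℂ] ℂ) (a : A), slice f (G.comul a) ∈ S := fun f a => by
    rw [← b.sum_repr a]
    simp only [map_sum, map_smul, comul_basis, slice_tmul]
    exact sum_mem fun j _ => S.smul_mem _ (sum_mem fun i _ => S.smul_mem _ (hS j i))
  have h2 : ∀ (f : A →ₗ[ℂ] ℂ) (X : A ⊗[ℂ] A), slice f X ∈ S := fun f X => by
    have hX : X ∈ Submodule.span ℂ {x | ∃ a b : A, x = G.comul b * ((1 : A) ⊗ₜ[ℂ] a)} := by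
      rw [G.span_comul_mul_right]; trivial
    induction hX using Submodule.span_induction with
    | mem _ hx =>
      obtain ⟨a, c, rfl⟩ := hx
      rw [slice_mul_one_tmul]
      exact h1 _ _
    | zero => simp
    | add X Y _ _ hX hY => rw [map_add]; exact add_mem hX hY
    | smul c X _ hX => rw [map_smul]; exact S.smul_mem _ hX
  rw [eq_top_iff]
  rintro x -
  nontriviality A
  obtain ⟨f, hf⟩ := SeparatingDual.exists_eq_one (R := ℂ) (one_ne_zero : (1 : A) ≠ 0)
  simpa [hf] using h2 (f : A →ₗ[ℂ] ℂ) (x ⊗ₜ 1)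

variable [DecidableEq ι] [PartialOrder A] [StarOrderedRing A] [Nontrivial A]

/-- Applying `id ⊗ h` to `Δ(b j (b k)⋆)`, invariance gives `w w⋆ = 1`; a one-sided inverse
of a matrix over a finite dimensional algebra is two-sided. -/
theorem isUnitaryCorep_regularCorep
    (hb : ∀ i j, regularState A (star (b i) * b j) = if i = j then 1 else 0) :
    G.IsUnitaryCorep (G.regularCorep b) := by
  refine ⟨?_, G.comul_regularCorep b⟩
  have hb' : ∀ i j, regularState A (b i * star (b j)) = if i = j then 1 else 0 := fun i j => by
    rw [regularState_mul_comm, hb]; simp only [eq_comm]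
  have hw : G.regularCorep b * star (G.regularCorep b) = 1 := by
    ext j k
    have := G.slice_comul_regularState (b j * star (b k))
    rw [hb', map_mul, map_star, comul_basis, comul_basis] at this
    simp only [star_sum, TensorProduct.star_tmul, Finset.sum_mul, Finset.mul_sum, map_sum,
      Algebra.TensorProduct.tmul_mul_tmul, slice_tmul, PositiveLinearMap.coe_toLinearMap,
      hb'] at this
    simp only [Matrix.mul_apply, Matrix.star_apply, Matrix.one_apply]
    simpa [apply_ite] using this
  have : IsNoetherianRing A := isNoetherian_of_tower ℂ inferInstance
  rw [Unitary.mem_iff]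
  exact ⟨mul_eq_one_comm.1 hw, hw⟩

end

theorem IsHaarState.eq [PartialOrder A] {G : CompactQuantumGroup A} {h k : A →ₚ[ℂ] ℂ}
    (hh : G.IsHaarState h) (hk : G.IsHaarState k) : h = k := by
  refine PositiveLinearMap.ext fun a => ?_
  have h1 := congrArg k (hh.right_invariant a)
  have h2 := congrArg h (hk.left_invariant a)
  have : ∀ X : A ⊗[ℂ] A, k (TensorProduct.lid ℂ A (h.toLinearMap.rTensor A X)) =
      h (TensorProduct.rid ℂ A (k.toLinearMap.lTensor A X)) := fun X => by
    induction X with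
    | zero => simp
    | tmul x y => simp [mul_comm]
    | add X Y hX hY => simp only [map_add, hX, hY]
  rw [this, h2] at h1
  simpa [Algebra.algebraMap_eq_smul_one, hh.map_one, hk.map_one] using h1.symm

variable [PartialOrder A] [StarOrderedRing A] [Nontrivial A]

theorem exists_unitaryCorep_span_eq_top :
    ∃ (n : ℕ) (w : Matrix (Fin n) (Fin n) A), G.IsUnitaryCorep w ∧
      Submodule.span ℂ (Set.range fun p : Fin n × Fin n => w p.1 p.2) = ⊤ := by
  obtain ⟨n, b, hb⟩ := exists_orthonormal_basis (h := regularState A)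
    fun a => regularState_faithful
  exact ⟨n, _, G.isUnitaryCorep_regularCorep b hb, G.span_regularCorep b⟩

theorem coeffAlgebra_eq_top : G.coeffAlgebra = ⊤ := by
  obtain ⟨n, w, hw, hs⟩ := G.exists_unitaryCorep_span_eq_top
  rw [eq_top_iff]
  rintro x -
  have hx : x ∈ Submodule.span ℂ (Set.range fun p : Fin n × Fin n => w p.1 p.2) := hs ▸ trivial
  refine (Submodule.span_mono ?_ hx : x ∈ Submodule.span ℂ G.matrixCoefficients)
  rintro _ ⟨p, rfl⟩
  exact ⟨Fin n, _, _, w, hw, p.1, p.2, rfl⟩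

/-- Right invariance follows from left invariance: for a unitary corepresentation `w`, left
invariance says that `P = h(w)` satisfies `w P = P`; hence `P = w⋆ P`, so `P⋆ = P⋆ w`, and applying
`h` gives `P⋆ = P⋆ P`. Thus `P` is self-adjoint and also `P w = P`. -/
theorem lid_rTensor_comul_regularState (a : A) :
    TensorProduct.lid ℂ A ((regularState A).toLinearMap.rTensor A (G.comul a)) =
      algebraMap ℂ A (regularState A a) := by
  obtain ⟨n, w, ⟨hu, hw⟩, hs⟩ := G.exists_unitaryCorep_span_eq_top
  set h := (regularState A).toLinearMap with hh
  have h1 : h 1 = 1 := regularState_one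
  let P : Matrix (Fin n) (Fin n) ℂ := w.map h
  let Q : Matrix (Fin n) (Fin n) A := P.map (algebraMap ℂ A)
  have hwQ : w * Q = Q := by
    ext i j
    have := G.slice_comul_regularState (w i j)
    simp only [hw, map_sum, slice_tmul] at this
    simpa [Matrix.mul_apply, P, Q, hh, ← Algebra.commutes, ← Algebra.smul_def] using this
  have hwQ' : star w * Q = Q := by
    conv_lhs => rw [← hwQ, ← mul_assoc, (Unitary.mem_iff.1 hu).1, one_mul]
  have hQw : star Q * w = star Q := by
    simpa using congrArg star hwQ'
  have hQs : star Q = (star P).map (algebraMap ℂ A) := by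
    ext i j
    exact (algebraMap_star_comm (P j i)).symm
  rw [hQs] at hQw
  have hPP : star P * P = star P := by
    ext i j
    have := congrArg h (congrFun (congrFun hQw i) j)
    simpa [Matrix.mul_apply, h1, ← Algebra.smul_def, Algebra.algebraMap_eq_smul_one, P]
      using this
  have hPs : star P = P := by
    have := congrArg star hPP
    rw [star_mul, star_star, hPP] at this
    exact this
  rw [hPs] at hQw
  have key : (TensorProduct.lid ℂ A).toLinearMap ∘ₗ h.rTensor A ∘ₗ G.comul.toAlgHom.toLinearMap =
      (Algebra.linearMap ℂ A) ∘ₗ h := by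
    refine LinearMap.ext_on_range hs fun p => ?_
    have := congrFun (congrFun hQw p.1) p.2
    simpa [hw, Matrix.mul_apply, P, ← Algebra.smul_def] using this
  exact LinearMap.congr_fun key a

theorem isHaarState_regularState : G.IsHaarState (regularState A) where
  map_one := regularState_one
  left_invariant := G.slice_comul_regularState
  right_invariant := G.lid_rTensor_comul_regularState

end CompactQuantumGroup

/-! ### The counit -/

namespace CompactQuantumGroup
variable {A : Type u} [CStarAlgebra A] [FiniteDimensional ℂ A] (G : CompactQuantumGroup A)

theorem IsCounit.eq {G : CompactQuantumGroup A} {ε δ : G.coeffAlgebra →ₐ[ℂ] ℂ}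
    (hε : G.IsCounit ε) (hδ : G.IsCounit δ) : ε = δ := by
  refine AlgHom.ext fun a => ?_
  obtain ⟨x, hx, -, hx2⟩ := hδ a
  obtain ⟨y, hy, hy1, -⟩ := hε a
  have hi : Function.Injective G.coeffAlgebra.val.toLinearMap := Subtype.val_injective
  obtain rfl : x = y := TensorProduct.map_injective_of_flat_flat _ _ hi hi (hx.trans hy.symm)
  have : ∀ X, ε (TensorProduct.rid ℂ _ (δ.toLinearMap.lTensor _ X)) =
      δ (TensorProduct.lid ℂ _ (ε.toLinearMap.rTensor _ X)) := fun X => by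
    induction X with
    | zero => simp
    | tmul u v => simp [mul_comm]
    | add X Y hX hY => simp only [map_add, hX, hY]
  have h := this x
  rwa [hx2, hy1] at h

/-- The map `a ↦ m (T⁻¹ (a ⊗ 1))`, where `T (a ⊗ b) = Δ(a) (1 ⊗ b)`. In terms of an antipode it is
`a ↦ a₍₁₎ S(a₍₂₎)`, which is why it will be the counit. -/
noncomputable def counitMap : A →ₗ[ℂ] A :=
  LinearMap.mul' ℂ A ∘ₗ (LinearEquiv.ofBijective _ G.rightCanonical_bijective).symm.toLinearMap ∘ₗ
    (Algebra.TensorProduct.includeLeft : A →ₐ[ℂ] A ⊗[ℂ] A).toLinearMap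

theorem lTensor_counitMap_comul (a : A) :
    G.counitMap.lTensor A (G.comul a) = a ⊗ₜ[ℂ] (1 : A) := by
  let Δ := G.comul.toAlgHom.toLinearMap
  let T := LinearEquiv.ofBijective _ G.rightCanonical_bijective
  have hT : ∀ x y, T (x ⊗ₜ y) = G.comul x * ((1 : A) ⊗ₜ[ℂ] y) := G.rightCanonical_tmul
  have h1 : ∀ (b : A) (Z : A ⊗[ℂ] A), TensorProduct.assoc ℂ A A A
      (Δ.rTensor A (Z * ((1 : A) ⊗ₜ[ℂ] b))) = TensorProduct.assoc ℂ A A A (Δ.rTensor A Z) *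
        ((1 : A) ⊗ₜ[ℂ] ((1 : A) ⊗ₜ[ℂ] b)) := fun b Z => by
    induction Z with
    | zero => simp
    | tmul x y =>
      simp only [Algebra.TensorProduct.tmul_mul_tmul, LinearMap.rTensor_tmul, mul_one]
      induction Δ x with
      | zero => simp
      | tmul u v => simp
      | add X Y hX hY => simp only [map_add, TensorProduct.add_tmul, add_mul, hX, hY]
    | add X Y hX hY => simp only [map_add, add_mul, hX, hY]
  -- the pentagon-type identity expressing coassociativity through `T`
  have h2 : ∀ X : A ⊗[ℂ] A, T.toLinearMap.lTensor A (TensorProduct.assoc ℂ A A A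
      (Δ.rTensor A X)) = TensorProduct.assoc ℂ A A A (Δ.rTensor A (T X)) := fun X => by
    induction X with
    | zero => simp
    | tmul x y =>
      rw [hT, h1, G.coassoc_apply, LinearMap.rTensor_tmul]
      change T.toLinearMap.lTensor A (TensorProduct.assoc ℂ A A A (G.comul x ⊗ₜ y)) = _
      induction G.comul x with
      | zero => simp
      | tmul u v => simp [hT]
      | add X Y hX hY => simp only [map_add, TensorProduct.add_tmul, add_mul, hX, hY]
    | add X Y hX hY => simp only [map_add, hX, hY]
  have h3 : ∀ X : A ⊗[ℂ] A, (LinearMap.mul' ℂ A).lTensor A (TensorProduct.assoc ℂ A A A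
      (Δ.rTensor A X)) = T X := fun X => by
    induction X with
    | zero => simp
    | tmul x y =>
      rw [hT, LinearMap.rTensor_tmul]
      change (LinearMap.mul' ℂ A).lTensor A (TensorProduct.assoc ℂ A A A (G.comul x ⊗ₜ y)) = _
      induction G.comul x with
      | zero => simp
      | tmul u v => simp
      | add X Y hX hY => simp only [map_add, TensorProduct.add_tmul, add_mul, hX, hY]
    | add X Y hX hY => simp only [map_add, hX, hY]
  have h4 : ∀ Z : A ⊗[ℂ] A, G.counitMap.lTensor A Z = (LinearMap.mul' ℂ A).lTensor A
      (T.symm.toLinearMap.lTensor A (TensorProduct.assoc ℂ A A A (Z ⊗ₜ (1 : A)))) := fun Z => by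
    induction Z with
    | zero => simp
    | tmul x y => rfl
    | add X Y hX hY => simp only [map_add, TensorProduct.add_tmul, hX, hY]
  have h5 := h2 (T.symm (a ⊗ₜ 1))
  rw [T.apply_symm_apply, LinearMap.rTensor_tmul] at h5
  change _ = TensorProduct.assoc ℂ A A A (G.comul a ⊗ₜ 1) at h5
  have h6 : ∀ W, T.symm.toLinearMap.lTensor A (T.toLinearMap.lTensor A W) = W := fun W => by
    rw [← LinearMap.lTensor_comp_apply, LinearEquiv.comp_coe, LinearEquiv.self_trans_symm,
      LinearEquiv.refl_toLinearMap, LinearMap.lTensor_id, LinearMap.id_apply]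
  rw [h4, ← h5, h6, h3, T.apply_symm_apply]

section
variable [Nontrivial A]

/-- The counit is multiplicative because `slice ε` is: it turns left multiplication by `Δ(a)` or by
`a ⊗ 1` into left multiplication by `a`, and `Δ(A) (A ⊗ 1)` spans `A ⊗ A`. -/
theorem exists_right_counit : ∃ ε : A →ₐ[ℂ] ℂ, ∀ a, slice ε.toLinearMap (G.comul a) = a := by
  obtain ⟨f, hf⟩ := SeparatingDual.exists_eq_one (R := ℂ) (one_ne_zero : (1 : A) ≠ 0)
  let ε : A →ₗ[ℂ] ℂ := (f : A →ₗ[ℂ] ℂ) ∘ₗ G.counitMap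
  have h1 : ∀ a, slice ε (G.comul a) = a := fun a => by
    have := congrArg (slice (f : A →ₗ[ℂ] ℂ)) (G.lTensor_counitMap_comul a)
    rw [slice_tmul, ContinuousLinearMap.coe_coe, hf, one_smul] at this
    refine Eq.trans ?_ this
    simp only [slice, ε, LinearMap.lTensor_comp, LinearMap.comp_apply]
  have h2 : ∀ (a : A) (Y : A ⊗[ℂ] A), slice ε (G.comul a * Y) = a * slice ε Y := fun a Y => by
    induction G.mem_span_comul_mul_left Y using Submodule.span_induction with
    | mem _ hx =>
      obtain ⟨c, b, rfl⟩ := hx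
      rw [← mul_assoc, ← map_mul, slice_mul_tmul_one, slice_mul_tmul_one, h1, h1, mul_assoc]
    | zero => simp
    | add X Y _ _ hX hY => rw [mul_add, map_add, map_add, mul_add, hX, hY]
    | smul c X _ hX => rw [mul_smul_comm, map_smul, map_smul, mul_smul_comm, hX]
  have h3 : ∀ X Y : A ⊗[ℂ] A, slice ε (X * Y) = slice ε X * slice ε Y := fun X Y => by
    induction G.mem_span_comul_mul_left X using Submodule.span_induction with
    | mem _ hx =>
      obtain ⟨c, b, rfl⟩ := hx
      rw [mul_assoc, h2, slice_tmul_one_mul, slice_mul_tmul_one, h1, mul_assoc]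
    | zero => simp
    | add X Y _ _ hX hY => rw [add_mul, map_add, map_add, add_mul, hX, hY]
    | smul c X _ hX => rw [smul_mul_assoc, map_smul, map_smul, smul_mul_assoc, hX]
  have h4 : ε 1 = 1 := by
    have := h1 1
    rw [map_one, Algebra.TensorProduct.one_def, slice_tmul] at this
    simpa [hf] using congrArg f this
  refine ⟨AlgHom.ofLinearMap ε h4 fun x y => ?_, h1⟩
  have := h3 (1 ⊗ₜ x) (1 ⊗ₜ y)
  simp only [Algebra.TensorProduct.tmul_mul_tmul, slice_tmul, mul_one, smul_mul_smul_comm] at this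
  simpa [hf] using congrArg f this

end

variable [PartialOrder A] [StarOrderedRing A] [Nontrivial A]

theorem exists_counit : ∃ ε : A →ₐ[ℂ] ℂ, (∀ a, slice ε.toLinearMap (G.comul a) = a) ∧
    ∀ a, TensorProduct.lid ℂ A (ε.toLinearMap.rTensor A (G.comul a)) = a := by
  obtain ⟨ε, hε⟩ := G.exists_right_counit
  refine ⟨ε, hε, ?_⟩
  obtain ⟨n, w, ⟨hu, hw⟩, hs⟩ := G.exists_unitaryCorep_span_eq_top
  -- `w ε(w) = w` for an invertible matrix `w`, hence `ε(w) = 1`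
  have h1 : w * w.map (fun x => algebraMap ℂ A (ε x)) = w := by
    ext i j
    have := hε (w i j)
    simp only [hw, map_sum, slice_tmul] at this
    simpa [Matrix.mul_apply, ← Algebra.commutes, ← Algebra.smul_def] using this
  have h2 : w.map (fun x => algebraMap ℂ A (ε x)) = 1 := by
    have := congrArg (star w * ·) h1
    simpa [← mul_assoc, (Unitary.mem_iff.1 hu).1] using this
  have key : (TensorProduct.lid ℂ A).toLinearMap ∘ₗ ε.toLinearMap.rTensor A ∘ₗ
      G.comul.toAlgHom.toLinearMap = LinearMap.id := by
    refine LinearMap.ext_on_range hs fun p => ?_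
    have : (w.map (fun x => algebraMap ℂ A (ε x)) * w) p.1 p.2 = w p.1 p.2 := by
      rw [h2, one_mul]
    simpa [hw, Matrix.mul_apply, ← Algebra.smul_def] using this
  exact LinearMap.congr_fun key

theorem val_coeffAlgebra_bijective : Function.Bijective G.coeffAlgebra.val :=
  ⟨Subtype.val_injective, fun x => ⟨⟨x, by rw [G.coeffAlgebra_eq_top]; trivial⟩, rfl⟩⟩

theorem isCounit_comp_val {ε : A →ₐ[ℂ] ℂ} (h1 : ∀ a, slice ε.toLinearMap (G.comul a) = a)
    (h2 : ∀ a, TensorProduct.lid ℂ A (ε.toLinearMap.rTensor A (G.comul a)) = a) :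
    G.IsCounit (ε.comp G.coeffAlgebra.val) := by
  intro a
  have hv := G.val_coeffAlgebra_bijective.2
  obtain ⟨x, hx⟩ := TensorProduct.map_surjective (g := G.coeffAlgebra.val.toLinearMap)
    (g' := G.coeffAlgebra.val.toLinearMap) hv hv (G.comul (a : A))
  refine ⟨x, hx, ?_, ?_⟩ <;> apply Subtype.val_injective
  · rw [← h2 (a : A), ← hx]
    clear hx
    induction x with
    | zero => simp
    | tmul u v => simp
    | add X Y hX hY => simp only [map_add, ← hX, ← hY]; rfl
  · rw [← h1 (a : A), ← hx]
    clear hx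
    induction x with
    | zero => simp
    | tmul u v => simp
    | add X Y hX hY => simp only [map_add, ← hX, ← hY]; rfl

end CompactQuantumGroup

/-! ### The idempotent of a character -/

/-- The idempotent `p` supporting a character `ε` has normalized trace `1 / dim A`. It is a multiple
of the element `q` representing `ε` through the trace form, `ε = h(· q)`. -/
theorem exists_idempotent_of_character {A : Type u} [CStarAlgebra A] [FiniteDimensional ℂ A]
    [PartialOrder A] [StarOrderedRing A] [Nontrivial A] (ε : A →ₐ[ℂ] ℂ) :
    ∃ p : A, (∀ a, a * p = ε a • p) ∧ ε p = 1 ∧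
      regularState A p = (Module.finrank ℂ A : ℂ)⁻¹ := by
  let B : A →ₗ[ℂ] A →ₗ[ℂ] ℂ := (LinearMap.mul ℂ A).flip.compr₂ (regularState A).toLinearMap
  have hnd : ∀ x, (∀ a, regularState A (a * x) = 0) → x = 0 := fun x hx =>
    regularState_faithful (hx (star x))
  have hinj : Function.Injective B := by
    rw [injective_iff_map_eq_zero]
    exact fun x hx => hnd x fun a => LinearMap.congr_fun hx a
  obtain ⟨q, hq⟩ := (LinearMap.injective_iff_surjective_of_finrank_eq_finrank
    (Subspace.dual_finrank_eq (K := ℂ) (V := A)).symm).1 hinj ε.toLinearMap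
  have hq : ∀ a, regularState A (a * q) = ε a := LinearMap.congr_fun hq
  have hl : ∀ a, a * q = ε a • q := fun a => by
    rw [← sub_eq_zero]
    refine hnd _ fun b => ?_
    rw [mul_sub, ← mul_assoc, map_sub, hq, mul_smul_comm, map_smul, hq, map_mul, smul_eq_mul,
      mul_comm, sub_self]
  have hr : ∀ a, q * a = ε a • q := fun a => by
    rw [← sub_eq_zero]
    refine hnd _ fun b => ?_
    rw [mul_sub, map_sub, ← mul_assoc, regularState_mul_comm (b * q), ← mul_assoc, hq,
      mul_smul_comm, map_smul, hq, map_mul, smul_eq_mul, sub_self]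
  have hN : (Module.finrank ℂ A : ℂ) ≠ 0 := Nat.cast_ne_zero.2 Module.finrank_pos.ne'
  have h1 : regularState A q = 1 := by simpa using hq 1
  -- left multiplication by `q` has rank one, `a ↦ ε(a) q`, so its trace is `ε(q)`
  have htr : regularTrace A q = ε q := by
    have : Algebra.lmul ℂ A q = LinearMap.toSpanSingleton ℂ A q ∘ₗ ε.toLinearMap := by
      ext a
      simpa using hr a
    have h2 : ε.toLinearMap ∘ₗ LinearMap.toSpanSingleton ℂ A q = ε q • LinearMap.id := by
      ext; simp
    rw [regularTrace_apply, this, LinearMap.trace_comp_comm', h2, map_smul, LinearMap.trace_id]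
    simp
  have hεq : ε q = Module.finrank ℂ A := by
    rw [regularState_apply, htr] at h1
    exact (inv_mul_eq_one₀ hN).1 h1 |>.symm
  refine ⟨(Module.finrank ℂ A : ℂ)⁻¹ • q, fun a => ?_, ?_, ?_⟩
  · rw [mul_smul_comm, hl, smul_comm]
  · rw [map_smul, hεq, smul_eq_mul, inv_mul_cancel₀ hN]
  · rw [map_smul, h1, smul_eq_mul, mul_one]

/-! ### The enveloping von Neumann algebra -/

section Enveloping
variable {A : Type u} [CStarAlgebra A] [PartialOrder A] [StarOrderedRing A]
  {h : A →ₚ[ℂ] ℂ}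

theorem gnsToVN_injective (hf : ∀ a, h (star a * a) = 0 → a = 0) :
    Function.Injective (gnsToVN h) := by
  rw [injective_iff_map_eq_zero]
  intro a ha
  have h1 : h.gnsStarAlgHom a = 0 := congrArg Subtype.val ha
  apply toGNS_injective hf
  rw [← mul_one a, ← gnsStarAlgHom_toGNS, h1, map_zero]
  rfl

theorem vnTrace_gnsToVN (a : A) : vnTrace h (gnsToVN h a) = h a := by
  change ⟪toGNS h 1, h.gnsStarAlgHom a (toGNS h 1)⟫_ℂ = h a
  rw [gnsStarAlgHom_toGNS, inner_toGNS, star_one, one_mul, mul_one]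

theorem vnTrace_add (x y : envelopingVN h) : vnTrace h (x + y) = vnTrace h x + vnTrace h y :=
  inner_add_right _ _ _

variable [FiniteDimensional ℂ A]

/-- For a faithful functional on a finite dimensional algebra `π_h(A)'' = π_h(A)`: the commutant
contains the right multiplications, and an operator commuting with those is a left
multiplication. -/
theorem gnsToVN_surjective (hf : ∀ a, h (star a * a) = 0 → a = 0) :
    Function.Surjective (gnsToVN h) := by
  have : FiniteDimensional ℂ h.GNS := (equivGNS h hf).finiteDimensional
  have hE : ∀ a, equivGNS h hf a = toGNS h a := fun _ => rfl
  let R : A → (h.GNS →L[ℂ] h.GNS) := fun b =>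
    LinearMap.toContinuousLinearMap ((equivGNS h hf).conj (LinearMap.mulRight ℂ b))
  have hR : ∀ b a, R b (toGNS h a) = toGNS h (a * b) := fun b a => by
    simp [R, ← hE, LinearEquiv.conj_apply_apply]
  have hcomm : ∀ a b, h.gnsStarAlgHom a * R b = R b * h.gnsStarAlgHom a := fun a b => by
    refine ContinuousLinearMap.ext fun x => ?_
    obtain ⟨c, rfl⟩ := toGNS_surjective h x
    change h.gnsStarAlgHom a (R b _) = R b (h.gnsStarAlgHom a _)
    rw [hR, gnsStarAlgHom_toGNS, gnsStarAlgHom_toGNS, hR, mul_assoc]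
  have hRmem : ∀ b, R b ∈ StarSubalgebra.centralizer ℂ
      (h.gnsStarAlgHom.range : Set (h.GNS →L[ℂ] h.GNS)) := fun b => by
    rw [StarSubalgebra.mem_centralizer_iff]
    rintro _ ⟨a, rfl⟩
    refine ⟨hcomm a b, ?_⟩
    change star (h.gnsStarAlgHom a) * _ = _ * star (h.gnsStarAlgHom a)
    rw [← map_star]
    exact hcomm _ b
  rintro ⟨x, hx⟩
  have hx' : x ∈ StarSubalgebra.centralizer ℂ (StarSubalgebra.centralizer ℂ
      (h.gnsStarAlgHom.range : Set (h.GNS →L[ℂ] h.GNS)) : Set (h.GNS →L[ℂ] h.GNS)) := hx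
  rw [StarSubalgebra.mem_centralizer_iff] at hx'
  obtain ⟨c, hc⟩ := toGNS_surjective h (x (toGNS h 1))
  refine ⟨c, Subtype.ext ?_⟩
  refine ContinuousLinearMap.ext fun y => ?_
  obtain ⟨b, rfl⟩ := toGNS_surjective h y
  change h.gnsStarAlgHom c _ = _
  have h1 := DFunLike.congr_fun (hx' (R b) (hRmem b)).1 (toGNS h 1)
  change R b (x _) = x (R b _) at h1
  rw [hR, one_mul, ← hc, hR] at h1
  rw [gnsStarAlgHom_toGNS, h1]

theorem vnTrace_mul_comm (hf : ∀ a, h (star a * a) = 0 → a = 0)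
    (ht : ∀ a b, h (a * b) = h (b * a)) (x y : envelopingVN h) :
    vnTrace h (x * y) = vnTrace h (y * x) := by
  obtain ⟨a, rfl⟩ := gnsToVN_surjective hf x
  obtain ⟨b, rfl⟩ := gnsToVN_surjective hf y
  rw [← map_mul, ← map_mul, vnTrace_gnsToVN, vnTrace_gnsToVN, ht]

end Enveloping

/-! ### Dimension and capacity of projective modules -/

/- The trace `τ` enters only through the hypotheses that it is additive and tracial. -/
section Dimension
variable {M : Type u} [Ring M] {τ : M → ℂ}

theorem exists_matrix_of_equiv {m n : ℕ} {e : Matrix (Fin m) (Fin m) M}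
    {f : Matrix (Fin n) (Fin n) M} (he : e * e = e) (hf : f * f = f)
    (φ : LinearMap.range e.vecMulLinear ≃ₗ[M] LinearMap.range f.vecMulLinear) :
    ∃ (x : Matrix (Fin m) (Fin n) M) (y : Matrix (Fin n) (Fin m) M), x * y = e ∧ y * x = f := by
  have hfix : ∀ {k : ℕ} {g : Matrix (Fin k) (Fin k) M}, g * g = g →
      ∀ v : LinearMap.range g.vecMulLinear, g.vecMulLinear.rangeRestrict v.1 = v := by
    rintro k g hg ⟨_, u, rfl⟩
    exact Subtype.ext (by simp [hg])
  let X : (Fin m → M) →ₗ[M] (Fin n → M) :=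
    Submodule.subtype _ ∘ₗ φ.toLinearMap ∘ₗ e.vecMulLinear.rangeRestrict
  let Y : (Fin n → M) →ₗ[M] (Fin m → M) :=
    Submodule.subtype _ ∘ₗ φ.symm.toLinearMap ∘ₗ f.vecMulLinear.rangeRestrict
  have hYX : Y ∘ₗ X = e.vecMulLinear := LinearMap.ext fun v => by simp [X, Y, hfix hf]
  have hXY : X ∘ₗ Y = f.vecMulLinear := LinearMap.ext fun v => by simp [X, Y, hfix he]
  refine ⟨LinearMap.toMatrixRight' X, LinearMap.toMatrixRight' Y, ?_, ?_⟩ <;>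
    apply Matrix.toLinearMapRight'.injective
  · rw [Matrix.toLinearMapRight'_mul, LinearEquiv.symm_apply_apply, LinearEquiv.symm_apply_apply]
    exact hYX
  · rw [Matrix.toLinearMapRight'_mul, LinearEquiv.symm_apply_apply, LinearEquiv.symm_apply_apply]
    exact hXY

/-- The dimension of a finitely generated projective module is well defined: isomorphic modules
`M^m e` and `M^n f` come from matrices with `e = x y` and `f = y x`. -/
theorem HasProjectiveDim.unique (hadd : ∀ x y, τ (x + y) = τ x + τ y)
    (hcomm : ∀ x y, τ (x * y) = τ (y * x)) {P Q : Type u} [AddCommGroup P] [Module M P]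
    [AddCommGroup Q] [Module M Q] (φ : P ≃ₗ[M] Q) {c d : ℝ} (hP : HasProjectiveDim τ P c)
    (hQ : HasProjectiveDim τ Q d) : c = d := by
  obtain ⟨m, e, he, ⟨α⟩, rfl⟩ := hP
  obtain ⟨n, f, hf, ⟨β⟩, rfl⟩ := hQ
  obtain ⟨x, y, rfl, rfl⟩ := exists_matrix_of_equiv he hf (α.symm.trans (φ.trans β))
  let T : M →+ ℂ := AddMonoidHom.mk' τ hadd
  have hT : ∀ x, τ x = T x := fun _ => rfl
  congr 1
  simp only [Matrix.mul_apply, hT, map_sum]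
  rw [Finset.sum_comm]
  simp only [← hT, hcomm]

theorem HasProjectiveDim.congr {P Q : Type u} [AddCommGroup P] [Module M P]
    [AddCommGroup Q] [Module M Q] (φ : P ≃ₗ[M] Q) {d : ℝ} (hP : HasProjectiveDim τ P d) :
    HasProjectiveDim τ Q d := by
  obtain ⟨m, e, he, ⟨α⟩, hd⟩ := hP
  exact ⟨m, e, he, ⟨φ.symm.trans α⟩, hd⟩

theorem HasProjectiveDim.projective {P : Type u} [AddCommGroup P] [Module M P] {d : ℝ}
    (hP : HasProjectiveDim τ P d) : Module.Projective M P := by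
  obtain ⟨m, e, he, ⟨α⟩, hd⟩ := hP
  have : Module.Projective M (LinearMap.range e.vecMulLinear) := by
    refine Module.Projective.of_split (Submodule.subtype _) e.vecMulLinear.rangeRestrict ?_
    ext ⟨_, u, rfl⟩ : 2
    simp [he]
  exact Module.Projective.of_equiv α.symm

theorem hasProjectiveDim_zero (P : Type u) [AddCommGroup P] [Module M P] [Subsingleton P] :
    HasProjectiveDim τ P 0 := by
  refine ⟨0, 0, Subsingleton.elim _ _, ⟨?_⟩, by simp⟩
  have : Subsingleton (LinearMap.range (0 : Matrix (Fin 0) (Fin 0) M).vecMulLinear) :=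
    inferInstance
  exact 0

theorem extendedDim_of_subsingleton (hadd : ∀ x y, τ (x + y) = τ x + τ y)
    (hcomm : ∀ x y, τ (x * y) = τ (y * x)) (Q : Type u) [AddCommGroup Q] [Module M Q]
    [Subsingleton Q] : extendedDim τ Q = 0 := by
  refine le_antisymm (iSup_le fun P => iSup₂_le fun d hd => ?_) zero_le
  rw [hd.unique hadd hcomm (LinearEquiv.refl M P) (hasProjectiveDim_zero P), ENNReal.ofReal_zero]

theorem HasProjectiveDim.ofReal_le_extendedDim {P Q : Type u} [AddCommGroup P] [Module M P]
    [AddCommGroup Q] [Module M Q] {d : ℝ} (hP : HasProjectiveDim τ P d) (f : P →ₗ[M] Q)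
    (hf : Function.Injective f) : ENNReal.ofReal d ≤ extendedDim τ Q :=
  le_iSup_of_le (LinearMap.range f) (le_iSup₂_of_le d
    (hP.congr (LinearEquiv.ofInjective f hf)) le_rfl)

theorem HasProjectiveDim.extendedDim_of_isSimpleModule (hadd : ∀ x y, τ (x + y) = τ x + τ y)
    (hcomm : ∀ x y, τ (x * y) = τ (y * x)) {Q : Type u} [AddCommGroup Q] [Module M Q]
    [IsSimpleModule M Q] {d : ℝ} (hQ : HasProjectiveDim τ Q d) :
    extendedDim τ Q = ENNReal.ofReal d := by
  refine le_antisymm (iSup_le fun P => iSup₂_le fun c hc => ?_)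
    (hQ.ofReal_le_extendedDim LinearMap.id Function.injective_id)
  rcases eq_bot_or_eq_top P with rfl | rfl
  · rw [hc.unique hadd hcomm (LinearEquiv.refl M _) (hasProjectiveDim_zero _), ENNReal.ofReal_zero]
    exact zero_le
  · rw [hc.unique hadd hcomm Submodule.topEquiv hQ]

/-- A projective module of positive dimension is not measurable: a surjection from a
zero-dimensional module onto it would split. -/
theorem HasProjectiveDim.not_isMeasurableModule {Q : Type u} [AddCommGroup Q] [Module M Q] {d : ℝ}
    (hQ : HasProjectiveDim τ Q d) (hd : 0 < d) : ¬ IsMeasurableModule τ Q := by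
  rintro ⟨m, n, f, h0, q, hq⟩
  have := hQ.projective
  obtain ⟨s, hs⟩ := Module.projective_lifting_property q LinearMap.id hq
  have hs' : Function.Injective s :=
    Function.LeftInverse.injective (g := q) fun x => LinearMap.congr_fun hs x
  have := hQ.ofReal_le_extendedDim s hs'
  rw [h0, nonpos_iff_eq_zero, ENNReal.ofReal_eq_zero] at this
  exact this.not_gt hd

variable [StarRing M]

/-- The zero module is presented by the `0 × 0` matrix, whose spectral density is constant. -/
theorem measurableCapacity_of_subsingleton (hadd : ∀ x y, τ (x + y) = τ x + τ y)
    (hcomm : ∀ x y, τ (x * y) = τ (y * x)) (N : Type u) [AddCommGroup N] [Module M N]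
    [Subsingleton N] : measurableCapacity τ N = ⊥ := by
  let f : Matrix (Fin 0) (Fin 0) M := 0
  have hf : IsZeroDimCover τ N f := by
    have : Subsingleton (Presented f) := (Submodule.mkQ_surjective _).subsingleton
    exact ⟨extendedDim_of_subsingleton hadd hcomm _, 0, fun x => ⟨0, Subsingleton.elim _ _⟩⟩
  have hs : ∀ l, spectralDensity τ f l = spectralDensity τ f 0 := fun l => by
    simp [spectralDensity, l2NormSq]
  have hle : measurableCapacity τ N ≤ matrixCapacity τ f :=
    iInf_le_of_le 0 (iInf_le_of_le 0 (iInf₂_le f hf))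
  refine le_bot_iff.1 (hle.trans ?_)
  rw [matrixCapacity, if_neg]
  intro h
  exact (h 1 one_pos).ne (hs 1).symm

theorem capacity_eq_bot (hadd : ∀ x y, τ (x + y) = τ x + τ y)
    (hcomm : ∀ x y, τ (x * y) = τ (y * x)) {Q : Type u} [AddCommGroup Q] [Module M Q]
    (h : ∀ (T : Submodule M Q) (N : Submodule M T), IsMeasurableModule τ N → Subsingleton N) :
    capacity τ Q = ⊥ := by
  refine le_bot_iff.1 (iSup₂_le fun T hT => iSup₂_le fun N hN => ?_)
  have := h T N (hT N hN)
  rw [measurableCapacity_of_subsingleton hadd hcomm]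

/-- A submodule of a submodule of `Q` is zero or isomorphic to `Q`, and `Q` is not measurable. -/
theorem HasProjectiveDim.capacity_of_isSimpleModule (hadd : ∀ x y, τ (x + y) = τ x + τ y)
    (hcomm : ∀ x y, τ (x * y) = τ (y * x)) {Q : Type u} [AddCommGroup Q] [Module M Q]
    [IsSimpleModule M Q] {d : ℝ} (hQ : HasProjectiveDim τ Q d) (hd : 0 < d) :
    capacity τ Q = ⊥ := by
  refine capacity_eq_bot hadd hcomm fun T N hN => ?_
  let φ := Submodule.equivMapOfInjective T.subtype T.injective_subtype N
  rcases eq_bot_or_eq_top (N.map T.subtype) with h | h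
  · rw [h] at φ
    exact φ.injective.subsingleton
  · rw [h] at φ
    exact absurd hN ((hQ.congr (φ.trans Submodule.topEquiv).symm).not_isMeasurableModule hd)

end Dimension

/-! ### Tor of a cyclic projective module -/

section Tor
variable {R M : Type u} [Ring R] [Ring M] (φ : R →+* M)

/-- `Tor₀` of a projective module is the tensor product. Such a module is its own projective
resolution, so right exactness of the tensor product is not needed. -/
noncomputable def torFunctorZeroIso (X : ModuleCat.{u} R) [Projective X] :
    (torFunctor φ 0).obj X ≅ (balancedTensor φ).obj X :=
  (ProjectiveResolution.self X).isoLeftDerivedObj (balancedTensor φ) 0 ≪≫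
    (HomologicalComplex.homologyFunctor _ _ 0).mapIso
      ((HomologicalComplex.singleMapHomologicalComplex (balancedTensor φ)
        (ComplexShape.down ℕ) 0).app X) ≪≫
    (HomologicalComplex.homologyFunctorSingleIso _ _ 0).app _

variable {X : Type u} [AddCommGroup X] [Module R X] (i : X →ₗ[R] R) (x₀ : X)

/-- If `i : X → R` is split by `r ↦ r x₀`, so that `X ≅ R p` for the idempotent `p = i x₀`, then
`M ⊗_R X ≅ M φ(p)`. -/
noncomputable def balancedTensorEquiv (hi : ∀ x, i x • x₀ = x) :
    ((M ⊗[ℤ] X) ⧸ balancedRelations φ X) ≃ₗ[M] LinearMap.range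
      (Matrix.of fun _ _ : Fin 1 => φ (i x₀) : Matrix (Fin 1) (Fin 1) M).vecMulLinear := by
  have hp : ∀ x, i x * i x₀ = i x := fun x => by
    rw [← smul_eq_mul, ← map_smul, hi]
  let F : (M ⊗[ℤ] X) →ₗ[M] (Fin 1 → M) := LinearMap.pi fun _ =>
    TensorProduct.AlgebraTensorModule.lift (LinearMap.toSpanSingleton M (X →ₗ[ℤ] M)
      (φ.toAddMonoidHom.toIntLinearMap ∘ₗ i.toAddMonoidHom.toIntLinearMap))
  have hF : ∀ m x, F (m ⊗ₜ x) = fun _ => m * φ (i x) := fun m x => by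
    ext; simp [F]
  have hFr : ∀ t, F t ∈ LinearMap.range
      (Matrix.of fun _ _ : Fin 1 => φ (i x₀) : Matrix (Fin 1) (Fin 1) M).vecMulLinear := fun t => by
    induction t with
    | zero => simp
    | tmul m x =>
      refine ⟨fun _ => m * φ (i x), ?_⟩
      ext
      simp [hF, Matrix.vecMul, dotProduct, mul_assoc, ← map_mul, hp]
    | add s t hs ht => rw [map_add]; exact add_mem hs ht
  have hle : balancedRelations φ X ≤ LinearMap.ker (F.codRestrict _ hFr) := by
    refine Submodule.span_le.2 ?_
    rintro _ ⟨m, r, x, rfl⟩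
    refine Subtype.ext ?_
    change F _ = 0
    rw [map_sub, hF, hF]
    ext
    simp [mul_assoc]
  refine LinearEquiv.ofLinearMap
    (Submodule.liftQ (balancedRelations φ X) (F.codRestrict _ hFr) hle)
    (Submodule.mkQ (balancedRelations φ X) ∘ₗ LinearMap.toSpanSingleton M _ (1 ⊗ₜ[ℤ] x₀) ∘ₗ
      LinearMap.proj 0 ∘ₗ Submodule.subtype _) ?_ ?_
  · ext ⟨_, u, rfl⟩ j
    fin_cases j
    simp [hF, Matrix.vecMul, dotProduct, mul_assoc, ← map_mul, hp, TensorProduct.smul_tmul']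
  · apply Submodule.linearMap_qext
    apply TensorProduct.AlgebraTensorModule.ext
    intro m x
    have h1 : ∀ (m : M) (r : R) (x : X), Submodule.Quotient.mk (p := balancedRelations φ X)
        ((m * φ r) ⊗ₜ[ℤ] x) = Submodule.Quotient.mk (m ⊗ₜ[ℤ] (r • x)) := fun m r x =>
      (Submodule.Quotient.eq _).2 (Submodule.subset_span ⟨m, r, x, rfl⟩)
    simp [hF, TensorProduct.smul_tmul', h1, hi]

end Tor

/-! ### The homology of the quantum group -/

namespace CompactQuantumGroup
variable {A : Type u} [CStarAlgebra A] [FiniteDimensional ℂ A] (G : CompactQuantumGroup A)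
  [PartialOrder A] [StarOrderedRing A] [Nontrivial A]

/-- The trivial module splits off the regular one: `z ↦ z p` for the idempotent `p` with
`a p = ε(a) p` and `ε(p) = 1` is split by `a ↦ ε(a)`. -/
theorem exists_splitting_counitModule (ε : A →ₐ[ℂ] ℂ) :
    ∃ (i : G.counitModule (ε.comp G.coeffAlgebra.val) →ₗ[G.coeffAlgebra] G.coeffAlgebra)
      (x₀ : G.counitModule (ε.comp G.coeffAlgebra.val)), (∀ x, i x • x₀ = x) ∧
      (∀ a : A, a * i x₀ = ε a • (i x₀ : A)) ∧ ε (i x₀) = 1 ∧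
      regularState A (i x₀) = (Module.finrank ℂ A : ℂ)⁻¹ := by
  obtain ⟨p, hp, hε, hr⟩ := exists_idempotent_of_character ε
  obtain ⟨p, rfl⟩ := G.val_coeffAlgebra_bijective.2 p
  let i : G.counitModule (ε.comp G.coeffAlgebra.val) →ₗ[G.coeffAlgebra] G.coeffAlgebra :=
    { toFun := fun z => (ULift.down z : ℂ) • p
      map_add' := fun x y => add_smul (ULift.down x : ℂ) (ULift.down y) p
      map_smul' := fun a z => Subtype.ext (by
        change (ε (a : A) * ULift.down z) • (p : A) = (a : A) * ((ULift.down z : ℂ) • (p : A))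
        rw [mul_smul_comm, mul_comm, mul_smul]
        exact congrArg _ (hp a).symm) }
  have h1 : i (ULift.up 1 : ULift.{u} ℂ) = p := one_smul ℂ p
  refine ⟨i, (ULift.up 1 : ULift.{u} ℂ), fun x => ?_, ?_⟩
  · refine ULift.ext _ _ ?_
    change ε ((ULift.down x : ℂ) • (p : A)) * 1 = ULift.down x
    rw [map_smul]
    change _ • ε (G.coeffAlgebra.val p) * 1 = _
    rw [hε, mul_one, smul_eq_mul, mul_one]
  · rw [h1]
    exact ⟨hp, hε, hr⟩

theorem projective_counitModule (ε : A →ₐ[ℂ] ℂ) :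
    Projective (G.counitModule (ε.comp G.coeffAlgebra.val)) := by
  obtain ⟨i, x₀, hi, -⟩ := G.exists_splitting_counitModule ε
  rw [← IsProjective.iff_projective]
  exact Module.Projective.of_split i (LinearMap.toSpanSingleton _ _ x₀) (LinearMap.ext hi)

/-- The zeroth `L²`-homology is one-dimensional over `ℂ`; as a module it is `M p` for the
idempotent `p` supporting the counit. -/
theorem l2Homology_zero (ε : A →ₐ[ℂ] ℂ) :
    IsSimpleModule (envelopingVN (regularState A))
      (G.l2Homology (regularState A) (ε.comp G.coeffAlgebra.val) 0) ∧
    HasProjectiveDim (vnTrace (regularState A))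
      (G.l2Homology (regularState A) (ε.comp G.coeffAlgebra.val) 0)
      (Module.finrank ℂ A : ℝ)⁻¹ := by
  have hf : ∀ a, regularState A (star a * a) = 0 → a = 0 := fun a => regularState_faithful
  have := G.projective_counitModule ε
  obtain ⟨i, x₀, hi, hp, hε, hr⟩ := G.exists_splitting_counitModule ε
  let φ : G.coeffAlgebra →+* envelopingVN (regularState A) :=
    (gnsToVN (regularState A)).comp (G.coeffAlgebra.val : G.coeffAlgebra →+* A)
  let e : Matrix (Fin 1) (Fin 1) (envelopingVN (regularState A)) := Matrix.of fun _ _ => φ (i x₀)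
  have hφ : φ (i x₀) = gnsToVN (regularState A) (i x₀) := rfl
  let α : G.l2Homology (regularState A) (ε.comp G.coeffAlgebra.val) 0
      ≃ₗ[envelopingVN (regularState A)] LinearMap.range e.vecMulLinear :=
    (torFunctorZeroIso φ _).toLinearEquiv.trans (balancedTensorEquiv φ i x₀ hi)
  -- since `a p = ε(a) p`, the module `M p` is the complex line through `p`
  have hmem : ∀ v : LinearMap.range e.vecMulLinear, ∃ c : ℂ, ∀ j, v.1 j =
      gnsToVN (regularState A) (c • (i x₀ : A)) := by
    rintro ⟨_, u, rfl⟩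
    obtain ⟨a, ha⟩ := gnsToVN_surjective hf (u 0)
    refine ⟨ε a, fun j => ?_⟩
    rw [← hp, map_mul, ha]
    simp [e, Matrix.vecMul, dotProduct, hφ]
  have hsimple : IsSimpleModule (envelopingVN (regularState A))
      (LinearMap.range e.vecMulLinear) := by
    rw [isSimpleModule_iff_toSpanSingleton_surjective]
    constructor
    · refine ⟨⟨e.vecMulLinear 1, 1, rfl⟩, 0, fun h => ?_⟩
      have h1 : e.vecMulLinear 1 0 = 0 := congrFun (congrArg Subtype.val h) 0
      have h2 : gnsToVN (regularState A) (i x₀) = 0 := by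
        simpa [e, Matrix.vecMul, dotProduct, hφ] using h1
      rw [(map_eq_zero_iff _ (gnsToVN_injective hf)).1 h2, map_zero] at hε
      exact zero_ne_one hε
    · intro v hv w
      obtain ⟨c, hc⟩ := hmem v
      obtain ⟨d, hd⟩ := hmem w
      have hc0 : c ≠ 0 := by
        rintro rfl
        exact hv (Subtype.ext (funext fun j => by rw [hc, zero_smul, map_zero]; rfl))
      refine ⟨gnsToVN (regularState A) ((d / c) • 1), Subtype.ext (funext fun j => ?_)⟩
      change gnsToVN (regularState A) ((d / c) • 1) * v.1 j = w.1 j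
      rw [hc, hd, ← map_mul, smul_mul_smul_comm, one_mul, div_mul_cancel₀ _ hc0]
  refine ⟨IsSimpleModule.congr α,
    HasProjectiveDim.congr α.symm ⟨1, e, ?_, ⟨LinearEquiv.refl _ _⟩, ?_⟩⟩
  · ext j k
    have : (i x₀ : A) * i x₀ = i x₀ := by rw [hp, hε, one_smul]
    simp [e, Matrix.mul_apply, hφ, ← map_mul, this]
  · simp only [e, Matrix.of_apply, hφ, vnTrace_gnsToVN, hr, Finset.univ_unique, Finset.sum_const,
      Finset.card_singleton, one_smul]
    rw [← Complex.ofReal_natCast, ← Complex.ofReal_inv, Complex.ofReal_re]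

theorem subsingleton_l2Homology (ε : A →ₐ[ℂ] ℂ) {n : ℕ} (hn : 1 ≤ n) :
    Subsingleton (G.l2Homology (regularState A) (ε.comp G.coeffAlgebra.val) n) := by
  obtain ⟨n, rfl⟩ := Nat.exists_eq_add_of_le' hn
  have := G.projective_counitModule ε
  exact ModuleCat.subsingleton_of_isZero (Functor.isZero_leftDerived_obj_projective_succ _ n _)

end CompactQuantumGroup

theorem mainTheorem8 {A : Type u} [CStarAlgebra A] [PartialOrder A] [StarOrderedRing A]
    [Nontrivial A] [FiniteDimensional ℂ A] (G : CompactQuantumGroup A) :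
    (∃! h : A →ₚ[ℂ] ℂ, G.IsHaarState h) ∧
    (∃! ε : G.coeffAlgebra →ₐ[ℂ] ℂ, G.IsCounit ε) ∧
    ∀ (h : A →ₚ[ℂ] ℂ) (ε : G.coeffAlgebra →ₐ[ℂ] ℂ), G.IsHaarState h → G.IsCounit ε →
      (∀ a b : A, h (a * b) = h (b * a)) ∧
      G.l2Betti h ε 0 = (Module.finrank ℂ A : ℝ≥0∞)⁻¹ ∧
      (∀ n : ℕ, 1 ≤ n → G.l2Betti h ε n = 0) ∧
      (∀ n : ℕ, G.nthCapacity h ε n = ⊥) := by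
  obtain ⟨ε₀, h1, h2⟩ := G.exists_counit
  have hε₀ := G.isCounit_comp_val h1 h2
  refine ⟨⟨_, G.isHaarState_regularState, fun _ hk => hk.eq G.isHaarState_regularState⟩,
    ⟨_, hε₀, fun _ hδ => hδ.eq hε₀⟩, fun h ε hh hε => ?_⟩
  obtain rfl := hh.eq G.isHaarState_regularState
  obtain rfl := hε.eq hε₀
  have hadd := vnTrace_add (h := regularState A)
  have hcomm := vnTrace_mul_comm (h := regularState A) (fun _ => regularState_faithful)
    regularState_mul_comm
  have hN : 0 < (Module.finrank ℂ A : ℝ) := Nat.cast_pos.2 Module.finrank_pos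
  obtain ⟨hs, hd⟩ := G.l2Homology_zero ε₀
  refine ⟨regularState_mul_comm, ?_, fun n hn => ?_, fun n => ?_⟩
  · rw [CompactQuantumGroup.l2Betti, hd.extendedDim_of_isSimpleModule hadd hcomm,
      ENNReal.ofReal_inv_of_pos hN, ENNReal.ofReal_natCast]
  · have := G.subsingleton_l2Homology ε₀ hn
    exact extendedDim_of_subsingleton hadd hcomm _
  · rcases n.eq_zero_or_pos with rfl | hn
    · exact hd.capacity_of_isSimpleModule hadd hcomm (inv_pos.2 hN)
    · have := G.subsingleton_l2Homology ε₀ hn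
      exact capacity_eq_bot hadd hcomm fun T N _ => N.injective_subtype.subsingleton
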